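/- Let $G$ be a second-countable, unimodular, amenable, non-compact locally compact (Hausdorff) group with Haar measure $\mu$, let $Q\subseteq G$ be a compact symmetric neighbourhood of the identity, and let $(K_n)_{n\in\mathbb N}$ be a strong Følner sequence in $G$, that is, a sequence of compact sets of positive measure such that $$\lim_{n\to\infty}\frac{\mu(K_nC\,\triangle\,K_n)}{\mu(K_n)}=0\quad\text{and}\quad \lim_{n\to\infty}\frac{\mu(K_nC\cap K_n^{c}C)}{\mu(K_n)}=0$$ for every non-empty compact set $C\subseteq G$. Let $(\pi,\mathcal H_\pi)$ be an irreducible projective unitary representation of $G$ on a Hilbert space, i.e. a strongly measurable map $\pi$ from $G$ into the unitary operators with $\pi(xy)=\sigma(x,y)\pi(x)\pi(y)$ for some $\sigma:G\times G\to\mathbb T$, having $\{0\}$ and $\mathcal H_\pi$ as its only closed invariant subspaces. Suppose that $\pi$ is square-integrable, i.e. $\int_G|\langle h,\pi(x)h\rangle|^2\,d\mu(x)<\infty$ for some $h\neq 0$, and let $d_\pi>0$ be its formal degree, i.e. the number with $$\int_G\langle f_1,\pi(x)g_1\rangle\langle\pi(x)g_2,f_2\rangle\,d\mu(x)=d_\pi^{-1}\langle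 f_1,f_2\rangle\overline{\langle g_1,g_2\rangle}\qquad\text{for all } f_1,f_2,g_1,g_2\in\mathcal H_\pi .$$ Let $\mathcal B^2_\pi$ be the set of all $g\in\mathcal H_\pi$ for which $V_gg:x\mapsto\langle g,\pi(x)g\rangle$ is locally essentially bounded and $x\mapsto\operatorname{ess\,sup}_{z\in Q}|V_gg(xz)|$ belongs to $L^2(G)$. For $\Lambda\subseteq G$ put $$D^+(\Lambda)=\limsup_{n\to\infty}\,\sup_{x\in G}\frac{\#(\Lambda\cap xK_n)}{\mu(K_n)} .$$ A family $(v_i)_{i\in I}$ in $\mathcal H_\pi$ is a frame if there are $A,B>0$ with $A\|f\|^2\le\sum_{i\in I}|\langle f,v_i\rangle|^2\le B\|f\|^2$ for all $f\in\mathcal H_\pi$. **Theorem.** Let $\Lambda\subseteq G$ be discrete and $g\in\mathcal B^2_\pi$. If $(\pi(\lambda)g)_{\lambda\in\Lambda}$ is a frame for $\mathcal H_\pi$ and $D^+(\Lambda)>d_\pi$, then there exists an infinite set $\Gamma\subset\Lambda$ such that $(\pi(\lambda)g)_{\lambda\in\Lambda\setminus\Gamma}$ is a frame for $\mathcal H_\pi$.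 -/

import Mathlib

open MeasureTheory Filter Topology Set
open scoped ENNReal Pointwise

noncomputable section

namespace CoherentFrame

/-! ### Følner sequences and Beurling density -/

section Density

variable {G : Type*} [Group G] [TopologicalSpace G] [MeasurableSpace G]

/-- A (right) Følner sequence: non-null compact sets `K n` such that
`μ (K n * C ∆ K n) / μ (K n) → 0` for every nonempty compact set `C`. (For `C = ∅` the quotient
is constantly `1`, so the empty set has to be left out.) -/
structure IsFolnerSeq (μ : Measure G) (K : ℕ → Set G) : Prop where
  isCompact : ∀ n, IsCompact (K n)
  measure_ne_zero : ∀ n, μ (K n) ≠ 0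
  tendsto_symmDiff : ∀ C : Set G, IsCompact C → C.Nonempty →
    Tendsto (fun n => μ (symmDiff (K n * C) (K n)) / μ (K n)) atTop (𝓝 0)

/-- A (right) strong Følner sequence: moreover `μ (K n * C ∩ (K n)ᶜ * C) / μ (K n) → 0` for every
compact set `C`. -/
structure IsStrongFolnerSeq (μ : Measure G) (K : ℕ → Set G) : Prop extends IsFolnerSeq μ K where
  tendsto_boundary : ∀ C : Set G, IsCompact C →
    Tendsto (fun n => μ ((K n * C) ∩ ((K n)ᶜ * C)) / μ (K n)) atTop (𝓝 0)

/-- The upper Beurling density `D⁺(Λ) = lim_n sup_x #(Λ ∩ x K_n) / μ (K_n)` of `Λ` along `K`,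
as an extended nonnegative real. It is written as a `limsup`, which equals the limit whenever
the limit exists. -/
def upperBeurlingDensity (μ : Measure G) (K : ℕ → Set G) (Λ : Set G) : ℝ≥0∞ :=
  limsup (fun n => ⨆ x : G, ((Λ ∩ x • K n).encard : ℝ≥0∞) / μ (K n)) atTop

end Density

/-! ### Local maximal functions and Wiener amalgam spaces -/

section Amalgam

variable {G : Type*} [Group G] [TopologicalSpace G] [MeasurableSpace G]

/-- The (left-sided) local maximal function `M^L F (x) = ess sup_{z ∈ Q} |F (x z)|`. -/
def localMax (μ : Measure G) (Q : Set G) (F : G → ℂ) (x : G) : ℝ≥0∞ :=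
  essSup (fun z => ‖F (x * z)‖ₑ) (μ.restrict Q)

/-- `F ∈ W^L(L^p)`: the function `F` is locally essentially bounded and `M^L F ∈ L^p`. -/
def MemAmalgam (μ : Measure G) (Q : Set G) (p : ℝ≥0∞) (F : G → ℂ) : Prop :=
  (∀ C : Set G, IsCompact C → MemLp F ∞ (μ.restrict C)) ∧ MemLp (localMax μ Q F) p μ

end Amalgam

/-! ### Frames -/

/-- The family `v` is a frame for `H`: there are `A, B > 0` with
`A ‖f‖² ≤ ∑ |⟨f, v i⟩|² ≤ B ‖f‖²` for all `f`. Mathlib's inner product is linear in the second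
argument, so `⟨f, v i⟩` is `inner ℂ (v i) f`. -/
def IsFrame {ι H : Type*} [NormedAddCommGroup H] [InnerProductSpace ℂ H] (v : ι → H) : Prop :=
  ∃ A B : ℝ, 0 < A ∧ 0 < B ∧ ∀ f : H,
    Summable (fun i => ‖inner ℂ (v i) f‖ ^ 2) ∧
    A * ‖f‖ ^ 2 ≤ ∑' i, ‖inner ℂ (v i) f‖ ^ 2 ∧
    ∑' i, ‖inner ℂ (v i) f‖ ^ 2 ≤ B * ‖f‖ ^ 2

/-! ### Projective unitary representations -/

/-- A projective unitary representation of `G` on `H`: a strongly measurable map into the unitary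
operators with `π (x y) = σ (x, y) π x π y` for some function `σ` with values in the circle. -/
structure ProjUnitaryRep (G H : Type*) [Group G] [TopologicalSpace G] [MeasurableSpace G]
    [NormedAddCommGroup H] [InnerProductSpace ℂ H] where
  toFun : G → (H ≃ₗᵢ[ℂ] H)
  stronglyMeasurable' : ∀ f : H, StronglyMeasurable (fun x => toFun x f)
  exists_cocycle' : ∃ σ : G → G → Circle, ∀ x y : G, ∀ f : H,
    toFun (x * y) f = (σ x y : ℂ) • toFun x (toFun y f)

namespace ProjUnitaryRep

variable {G H : Type*} [Group G] [TopologicalSpace G] [MeasurableSpace G]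
  [NormedAddCommGroup H] [InnerProductSpace ℂ H]

instance : CoeFun (ProjUnitaryRep G H) (fun _ => G → (H ≃ₗᵢ[ℂ] H)) := ⟨ProjUnitaryRep.toFun⟩

/-- The coefficient transform `V_g f (x) = ⟨f, π(x) g⟩` (linear in `f`). -/
def coeff (π : ProjUnitaryRep G H) (g f : H) (x : G) : ℂ := inner ℂ (π x g) f

/-- The only closed invariant subspaces are `{0}` and `H`. -/
def IsIrreducible (π : ProjUnitaryRep G H) : Prop :=
  ∀ W : Submodule ℂ H, IsClosed (W : Set H) → (∀ x : G, ∀ f ∈ W, π x f ∈ W) → W = ⊥ ∨ W = ⊤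

/-- A discrete series (irreducible square-integrable) representation. -/
structure IsDiscreteSeries (π : ProjUnitaryRep G H) (μ : Measure G) : Prop where
  irreducible : π.IsIrreducible
  squareIntegrable : ∃ g : H, g ≠ 0 ∧ ∫⁻ x, ‖π.coeff g g x‖ₑ ^ 2 ∂μ < ∞

/-- The orthogonality relations with constant `d`:
`∫ ⟨f₁, π(x) g₁⟩ ⟨π(x) g₂, f₂⟩ dμ(x) = d⁻¹ ⟨f₁, f₂⟩ conj ⟨g₁, g₂⟩` for all `f₁, f₂, g₁, g₂`, with
brackets linear in the first argument. -/
def IsFormalDegree (π : ProjUnitaryRep G H) (μ : Measure G) (d : ℝ) : Prop :=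
  0 < d ∧ ∀ f₁ f₂ g₁ g₂ : H,
    ∫ x, π.coeff g₁ f₁ x * (starRingEnd ℂ) (π.coeff g₂ f₂ x) ∂μ =
      (d : ℂ)⁻¹ * inner ℂ f₂ f₁ * (starRingEnd ℂ) (inner ℂ g₂ g₁)

theorem IsFormalDegree.unique [Nontrivial H] {π : ProjUnitaryRep G H} {μ : Measure G} {d d' : ℝ}
    (h : π.IsFormalDegree μ d) (h' : π.IsFormalDegree μ d') : d = d' := by
  obtain ⟨f, hf⟩ := exists_ne (0 : H)
  have e := (h.2 f f f f).symm.trans (h'.2 f f f f)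
  have hi : inner ℂ f f ≠ 0 := inner_self_ne_zero.mpr hf
  have hi' : (starRingEnd ℂ) (inner ℂ f f) ≠ 0 := by simpa using hi
  have e' := mul_right_cancel₀ hi (mul_right_cancel₀ hi' e)
  exact_mod_cast inv_injective e'

open Classical in
/-- The formal degree `d_π`: the number `d > 0` for which the orthogonality relations hold
(it exists and is unique for a discrete series representation of a unimodular group). -/
def formalDegree (π : ProjUnitaryRep G H) (μ : Measure G) : ℝ :=
  if h : ∃ d : ℝ, π.IsFormalDegree μ d then h.choose else 0

/-- The set `B²_π = {g | V_g g ∈ W^L(L²)}`. -/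
def B2 (π : ProjUnitaryRep G H) (μ : Measure G) (Q : Set G) : Set H :=
  {g | MemAmalgam μ Q 2 (π.coeff g g)}

end ProjUnitaryRep

end CoherentFrame

end

/-! Let `R` be the inverse of the frame operator of the vectors v_l = π(l)g, and put p_l = ⟨v_l, R
v_l⟩ ≥ 0. The proof joins a removal principle for abstract frames to a trace comparison.

Removal (`IsFrame.exists_infinite_compl`): suppose p_l ≤ α < 1 for infinitely many l. For fixed i
the numbers ⟨v_i, R v_j⟩ tend to 0, so a sparse sequence of such indices has a Gram matrix (⟨v_i, R
v_j⟩) that is nearly diagonal, with norm at most some β < 1. The chosen vectors then carry at most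
the fraction β of ∑ |⟨v_l, f⟩|², and deleting them keeps the lower frame bound (1 - β)A.

Trace comparison (`IsFormalDegree.eventually_sum_re_inner_le`): the orthogonality relations turn
d⁻¹‖g‖² p_l into the integral over x of ⟨π(x)g, v_l⟩⟨v_l, R π(x)g⟩ (up to conjugation conventions),
while the reconstruction formula says that for each x these integrands sum over l to ‖g‖². Both
statements localise: V_g g ∈ L² concentrates each integrand near l, and g ∈ B² makes the tails of
the sum over l small uniformly in almost every x. Hence the sum of p_l over Λ ∩ yK_n is at most
about d μ(K_n), the error coming from the Følner boundary and a small multiple of the number of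
points. If D⁺(Λ) > d, some translates contain so many points that the average of p_l stays below 1;
as μ(K_n) → ∞, finitely many l cannot be responsible (`IsFormalDegree.exists_infinite_re_inner_le`).

Since `formalDegree` takes the value 0 when no constant fits, the orthogonality relations have to be
proved as well. They follow from Schur's lemma applied on the graph of f ↦ V_h f. -/

namespace CoherentFrame

/-! ### Inversion invariance of Haar measure -/

section Unimodular

variable {G : Type*} [Group G] [TopologicalSpace G] [IsTopologicalGroup G] [LocallyCompactSpace G]
  [SecondCountableTopology G] [MeasurableSpace G] [BorelSpace G]

/-- A bi-invariant Haar measure is invariant under inversion. -/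
theorem isInvInvariant_of_isMulRightInvariant (μ : Measure G) [μ.IsHaarMeasure]
    [μ.IsMulRightInvariant] : μ.IsInvInvariant := by
  have hfin : IsFiniteMeasureOnCompacts μ.inv := by
    refine ⟨fun K hK => ?_⟩
    rw [Measure.inv_apply]
    exact hK.inv.measure_lt_top
  -- Right invariance of `μ` makes `μ.inv` left invariant, hence a multiple of `μ`. A symmetric
  -- compact neighbourhood of 1 has the same finite nonzero mass for both, so the factor is 1.
  have h := Measure.isMulLeftInvariant_eq_smul μ.inv μ
  set c := μ.inv.haarScalarFactor μ
  obtain ⟨K, hK, hK1⟩ := exists_compact_mem_nhds (1 : G)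
  have hU1 : K ∪ K⁻¹ ∈ 𝓝 (1 : G) := mem_of_superset hK1 subset_union_left
  have hUc : IsCompact (K ∪ K⁻¹) := hK.union hK.inv
  have hUs : (K ∪ K⁻¹)⁻¹ = K ∪ K⁻¹ := by rw [union_inv, inv_inv, union_comm]
  have h0 : μ (K ∪ K⁻¹) ≠ 0 := (Measure.measure_pos_of_mem_nhds μ hU1).ne'
  have ht : μ (K ∪ K⁻¹) ≠ ∞ := hUc.measure_lt_top.ne
  have e : μ (K ∪ K⁻¹) = (c : ℝ≥0∞) * μ (K ∪ K⁻¹) := by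
    have := congrArg (fun m : Measure G => m (K ∪ K⁻¹)) h
    simpa [Measure.inv_apply, hUs, Measure.smul_apply, -union_inv] using this
  have hc : (c : ℝ≥0∞) = 1 := by
    have := (ENNReal.mul_left_inj (a := 1) (b := (c : ℝ≥0∞)) h0 ht).mp (by rw [one_mul]; exact e)
    exact this.symm
  have hc' : c = 1 := by exact_mod_cast hc
  refine ⟨?_⟩
  rw [h, hc', one_smul]

end Unimodular

/-! ### Cocycle identities and Schur's lemma -/

namespace ProjUnitaryRep

section Algebra

variable {G H : Type*} [Group G] [TopologicalSpace G] [MeasurableSpace G]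
  [NormedAddCommGroup H] [InnerProductSpace ℂ H] (π : ProjUnitaryRep G H)

theorem stronglyMeasurable_coeff (g f : H) : StronglyMeasurable (π.coeff g f) :=
  (π.stronglyMeasurable' g).inner stronglyMeasurable_const

theorem coeff_map_mul_conj (h f₁ f₂ : H) (x y : G) :
    π.coeff h (π x f₁) (x * y) * (starRingEnd ℂ) (π.coeff h (π x f₂) (x * y)) =
      π.coeff h f₁ y * (starRingEnd ℂ) (π.coeff h f₂ y) := by
  obtain ⟨σ, hσ⟩ := π.exists_cocycle'
  have key : ∀ f, π.coeff h (π x f) (x * y) = (starRingEnd ℂ) (σ x y : ℂ) * π.coeff h f y := by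
    intro f
    simp only [coeff]
    rw [hσ, inner_smul_left, LinearIsometryEquiv.inner_map_map]
  have hc : (starRingEnd ℂ) (σ x y : ℂ) * (σ x y : ℂ) = 1 := by
    rw [← Circle.coe_inv_eq_conj, ← Circle.coe_mul, inv_mul_cancel, Circle.coe_one]
  rw [key, key, map_mul, Complex.conj_conj]
  linear_combination (π.coeff h f₁ y * (starRingEnd ℂ) (π.coeff h f₂ y)) * hc

theorem norm_inner_map_mul (x y : G) (a b : H) :
    ‖inner ℂ (π x a) (π (x * y) b)‖ = ‖inner ℂ a (π y b)‖ := by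
  obtain ⟨σ, hσ⟩ := π.exists_cocycle'
  rw [hσ, inner_smul_right, LinearIsometryEquiv.inner_map_map, norm_mul, Circle.norm_coe, one_mul]

theorem norm_inner_map_map (x y : G) (a b : H) :
    ‖inner ℂ (π x a) (π y b)‖ = ‖π.coeff b a (x⁻¹ * y)‖ := by
  rw [coeff, norm_inner_symm (π (x⁻¹ * y) b) a, ← π.norm_inner_map_mul x (x⁻¹ * y) a b,
    mul_inv_cancel_left]

theorem norm_coeff_inv (g f : H) (x : G) : ‖π.coeff g f x⁻¹‖ = ‖π.coeff f g x‖ := by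
  have h := π.norm_inner_map_mul x x⁻¹ f g
  obtain ⟨σ, hσ⟩ := π.exists_cocycle'
  have h1 : ∀ b, π 1 b = (σ 1 1 : ℂ)⁻¹ • b := by
    intro b
    have := hσ 1 1 b
    rw [mul_one] at this
    have h2 : π 1 ((σ 1 1 : ℂ) • π 1 b) = π 1 b := by rw [map_smul]; exact this.symm
    have h3 := (π 1).injective h2
    rw [← h3, smul_smul, inv_mul_cancel₀ (Circle.coe_ne_zero _), one_smul, h3]
  rw [mul_inv_cancel, h1, inner_smul_right, norm_mul, norm_inv, Circle.norm_coe, inv_one,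
    one_mul] at h
  rw [coeff, coeff, norm_inner_symm, ← h]

end Algebra

section Schur

variable {G H : Type*} [Group G] [TopologicalSpace G] [MeasurableSpace G]
  [NormedAddCommGroup H] [InnerProductSpace ℂ H] [CompleteSpace H] {π : ProjUnitaryRep G H}

/-- Schur's lemma for self-adjoint operators. -/
theorem IsIrreducible.exists_eq_smul (hπ : π.IsIrreducible) {R : H →L[ℂ] H}
    (hR : IsSelfAdjoint R) (hcomm : ∀ x f, R (π x f) = π x (R f)) : ∃ r : ℝ, R = r • 1 := by
  -- Each `cfc φ R` commutes with every `π x`, so its kernel is closed and invariant.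
  have hdich : ∀ φ : ℝ → ℝ, cfc φ R = 0 ∨ Function.Injective (cfc φ R : H →L[ℂ] H) := by
    intro φ
    have hc : ∀ x f, (cfc φ R) (π x f) = π x ((cfc φ R) f) := by
      intro x f
      let U : H →L[ℂ] H := ((π x).toContinuousLinearEquiv : H →L[ℂ] H)
      have hU : Commute R U := by
        ext f
        exact hcomm x f
      have := hU.cfc_real φ
      exact congrArg (fun T : H →L[ℂ] H => T f) this.eq
    rcases hπ (LinearMap.ker (cfc φ R : H →L[ℂ] H).toLinearMap)
      (ContinuousLinearMap.isClosed_ker _) (fun x f hf => by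
        simp only [LinearMap.mem_ker, ContinuousLinearMap.coe_coe] at hf ⊢
        rw [hc, hf, map_zero]) with h | h
    · right
      exact LinearMap.ker_eq_bot.mp h
    · left
      ext f
      have : f ∈ LinearMap.ker (cfc φ R : H →L[ℂ] H).toLinearMap := by rw [h]; trivial
      simpa using this
  rcases subsingleton_or_nontrivial H with hH | hH
  · exact ⟨0, by ext f; exact Subsingleton.elim _ _⟩
  obtain ⟨r, hr⟩ : (spectrum ℝ R).Nonempty := ContinuousFunctionalCalculus.spectrum_nonempty R hR
  refine ⟨r, ?_⟩
  -- Two spectral points would carry tent functions with disjoint supports. These give two nonzero,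
  -- hence injective, operators whose product is zero.
  have hsub : spectrum ℝ R ⊆ {r} := by
    intro s hs
    by_contra hne
    simp only [mem_singleton_iff] at hne
    let φ : ℝ → ℝ := fun t => max (|s - r| / 2 - |t - r|) 0
    let ψ : ℝ → ℝ := fun t => max (|s - r| / 2 - |t - s|) 0
    have hφ : Continuous φ := by fun_prop
    have hψ : Continuous ψ := by fun_prop
    have hpos : 0 < |s - r| := abs_pos.mpr (sub_ne_zero.mpr hne)
    have hprod : cfc φ R * cfc ψ R = 0 := by
      rw [← cfc_mul φ ψ R hφ.continuousOn hψ.continuousOn]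
      have : (fun t => φ t * ψ t) = fun _ => 0 := by
        funext t
        have htri : |s - r| ≤ |t - r| + |t - s| := by
          have := abs_sub_le s t r
          rw [abs_sub_comm s t] at this
          linarith
        rcases le_total (|s - r| / 2) |t - r| with h | h
        · have : φ t = 0 := max_eq_right (by linarith)
          rw [this, zero_mul]
        · have : ψ t = 0 := max_eq_right (by linarith)
          rw [this, mul_zero]
      rw [this, cfc_const_zero]
    have hφ0 : cfc φ R ≠ 0 := by
      intro h0
      have := (cfc_eq_cfc_iff_eqOn (a := R) hφ.continuousOn continuousOn_const (ha := hR)).mp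
        (h0.trans (cfc_const_zero ℝ R).symm) hr
      simp only [φ, sub_self, abs_zero, sub_zero] at this
      have := le_max_left (|s - r| / 2) 0
      linarith
    have hψ0 : cfc ψ R ≠ 0 := by
      intro h0
      have := (cfc_eq_cfc_iff_eqOn (a := R) hψ.continuousOn continuousOn_const (ha := hR)).mp
        (h0.trans (cfc_const_zero ℝ R).symm) hs
      simp only [ψ, sub_self, abs_zero, sub_zero] at this
      have := le_max_left (|s - r| / 2) 0
      linarith
    have hinj := (hdich φ).resolve_left hφ0
    apply hψ0
    ext f
    apply hinj
    have := congrArg (fun T : H →L[ℂ] H => T f) hprod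
    simpa using this
  rw [CFC.eq_algebraMap_of_spectrum_subset_singleton R r hsub hR, Algebra.algebraMap_eq_smul_one]

end Schur

end ProjUnitaryRep

/-! ### Orthogonality relations and formal degree -/

namespace ProjUnitaryRep

section Domain

variable {G H : Type*} [Group G] [TopologicalSpace G] [MeasurableSpace G]
  [NormedAddCommGroup H] [InnerProductSpace ℂ H] {π : ProjUnitaryRep G H} {μ : Measure G}

theorem coeff_add_right (h f₁ f₂ : H) : π.coeff h (f₁ + f₂) = π.coeff h f₁ + π.coeff h f₂ := by
  funext x
  simp [coeff]

theorem coeff_smul_right (h f : H) (c : ℂ) : π.coeff h (c • f) = c • π.coeff h f := by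
  funext x
  simp [coeff]

theorem coeff_add_left (h₁ h₂ f : H) : π.coeff (h₁ + h₂) f = π.coeff h₁ f + π.coeff h₂ f := by
  funext x
  simp [coeff]

theorem coeff_smul_left (h f : H) (c : ℂ) :
    π.coeff (c • h) f = (starRingEnd ℂ) c • π.coeff h f := by
  funext x
  simp [coeff, mul_comm]

variable (π) in
theorem memLp_coeff_iff (h f : H) :
    MemLp (π.coeff h f) 2 μ ↔ Integrable (fun x => ‖π.coeff h f x‖ ^ 2) μ :=
  memLp_two_iff_integrable_sq_norm (π.stronglyMeasurable_coeff h f).aestronglyMeasurable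

variable (π μ) in
/-- The graph of the coefficient transform `f ↦ V_h f`, on its natural `L²` domain. -/
def coeffGraph (h : H) : Submodule ℂ (WithLp 2 (H × Lp ℂ 2 μ)) where
  carrier := {p | (p.snd : G → ℂ) =ᵐ[μ] π.coeff h p.fst}
  add_mem' := by
    intro p q hp hq
    simp only [mem_ofPred_eq, WithLp.add_fst, WithLp.add_snd] at hp hq ⊢
    rw [coeff_add_right]
    exact (Lp.coeFn_add _ _).trans (hp.add hq)
  zero_mem' := by
    simp only [mem_ofPred_eq, WithLp.zero_fst, WithLp.zero_snd]
    refine (Lp.coeFn_zero ℂ 2 μ).trans (Eventually.of_forall fun x => ?_)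
    simp [coeff]
  smul_mem' := by
    intro c p hp
    simp only [mem_ofPred_eq, WithLp.smul_fst, WithLp.smul_snd] at hp ⊢
    rw [coeff_smul_right]
    exact (Lp.coeFn_smul _ _).trans (hp.const_smul c)

theorem mem_coeffGraph {h : H} {p : WithLp 2 (H × Lp ℂ 2 μ)} :
    p ∈ coeffGraph π μ h ↔ (p.snd : G → ℂ) =ᵐ[μ] π.coeff h p.fst := Iff.rfl

/-- An `L²`-convergent sequence has an a.e. convergent subsequence, and V_h f(x) depends
continuously on f for each x. Closedness makes the graph a Hilbert space, so that adjoints are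
available on it. -/
theorem isClosed_coeffGraph (h : H) :
    IsClosed (coeffGraph π μ h : Set (WithLp 2 (H × Lp ℂ 2 μ))) := by
  refine isClosed_of_closure_subset fun p hp => ?_
  obtain ⟨u, hu, hup⟩ := mem_closure_iff_seq_limit.mp hp
  have h1 : Tendsto (fun n => (u n).fst) atTop (𝓝 p.fst) :=
    ((WithLp.continuous_fst 2 H (Lp ℂ 2 μ)).tendsto p).comp hup
  have h2 : Tendsto (fun n => (u n).snd) atTop (𝓝 p.snd) :=
    ((WithLp.continuous_snd 2 H (Lp ℂ 2 μ)).tendsto p).comp hup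
  obtain ⟨ns, hns, hae⟩ := (tendstoInMeasure_of_tendsto_Lp h2).exists_seq_tendsto_ae
  have hall : ∀ᵐ x ∂μ, ∀ n, ((u n).snd : G → ℂ) x = π.coeff h (u n).fst x :=
    ae_all_iff.mpr fun n => hu n
  change (p.snd : G → ℂ) =ᵐ[μ] π.coeff h p.fst
  filter_upwards [hae, hall] with x hx1 hx2
  refine tendsto_nhds_unique hx1 ?_
  simp_rw [hx2]
  exact tendsto_const_nhds.inner (h1.comp hns.tendsto_atTop)

theorem inner_coeffGraph {h : H} {p q : WithLp 2 (H × Lp ℂ 2 μ)}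
    (hp : p ∈ coeffGraph π μ h) (hq : q ∈ coeffGraph π μ h) :
    inner ℂ p q = inner ℂ p.fst q.fst +
      ∫ x, π.coeff h q.fst x * (starRingEnd ℂ) (π.coeff h p.fst x) ∂μ := by
  rw [WithLp.prod_inner_apply, L2.inner_def]
  congr 1
  refine integral_congr_ae ?_
  filter_upwards [mem_coeffGraph.mp hp, mem_coeffGraph.mp hq] with x h1 h2
  change inner ℂ ((p.snd : G → ℂ) x) ((q.snd : G → ℂ) x) = _
  rw [h1, h2]
  simp

theorem exists_mem_coeffGraph {h f : H} (hf : MemLp (π.coeff h f) 2 μ) :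
    ∃ p ∈ coeffGraph π μ h, p.fst = f :=
  ⟨WithLp.toLp 2 (f, hf.toLp _), hf.coeFn_toLp, rfl⟩

theorem memLp_of_mem_coeffGraph {h : H} {p : WithLp 2 (H × Lp ℂ 2 μ)}
    (hp : p ∈ coeffGraph π μ h) : MemLp (π.coeff h p.fst) 2 μ :=
  (memLp_congr_ae hp).mp (Lp.memLp p.snd)

variable [IsTopologicalGroup G] [BorelSpace G]

theorem integral_coeff_map_mul_conj [μ.IsMulLeftInvariant] (h f₁ f₂ : H) (x : G) :
    ∫ y, π.coeff h (π x f₁) y * (starRingEnd ℂ) (π.coeff h (π x f₂) y) ∂μ =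
      ∫ y, π.coeff h f₁ y * (starRingEnd ℂ) (π.coeff h f₂ y) ∂μ := by
  rw [← integral_mul_left_eq_self _ x]
  simp_rw [coeff_map_mul_conj]

theorem integral_norm_coeff_sq_swap [μ.IsInvInvariant] (f g : H) :
    ∫ x, ‖π.coeff f g x‖ ^ 2 ∂μ = ∫ x, ‖π.coeff g f x‖ ^ 2 ∂μ := by
  rw [← integral_inv_eq_self]
  simp only [norm_coeff_inv]

theorem memLp_coeff_swap [μ.IsInvInvariant] {f g : H} (h : MemLp (π.coeff g f) 2 μ) :
    MemLp (π.coeff f g) 2 μ := by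
  rw [memLp_coeff_iff] at h ⊢
  simpa only [norm_coeff_inv] using h.comp_inv

theorem memLp_coeff_map [μ.IsMulLeftInvariant] {h f : H} (x : G)
    (hf : MemLp (π.coeff h f) 2 μ) : MemLp (π.coeff h (π x f)) 2 μ := by
  rw [memLp_coeff_iff] at hf ⊢
  have : (fun y => ‖π.coeff h (π x f) y‖ ^ 2) = fun y => ‖π.coeff h f (x⁻¹ * y)‖ ^ 2 := by
    funext y
    have e := π.coeff_map_mul_conj h f f x (x⁻¹ * y)
    rw [mul_inv_cancel_left, Complex.mul_conj, Complex.mul_conj] at e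
    rw [← Complex.normSq_eq_norm_sq, ← Complex.normSq_eq_norm_sq]
    exact_mod_cast e
  rw [this]
  exact hf.comp_mul_left x⁻¹

end Domain

section Orthogonality

variable {G H : Type*} [Group G] [TopologicalSpace G] [IsTopologicalGroup G]
  [MeasurableSpace G] [BorelSpace G]
  [NormedAddCommGroup H] [InnerProductSpace ℂ H] [CompleteSpace H] {π : ProjUnitaryRep G H}
  {μ : Measure G}

/-- If `V_h` has a nonzero vector in its `L²` domain, then it is everywhere defined and a multiple
of an isometry. -/
theorem IsIrreducible.exists_integral_norm_coeff_sq [μ.IsMulLeftInvariant]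
    (hπ : π.IsIrreducible) {h f₀ : H}
    (hf₀ : f₀ ≠ 0) (hmem : MemLp (π.coeff h f₀) 2 μ) :
    ∃ C : ℝ, ∀ f : H, MemLp (π.coeff h f) 2 μ ∧ ∫ x, ‖π.coeff h f x‖ ^ 2 ∂μ = C * ‖f‖ ^ 2 := by
  have hcomplete : CompleteSpace (coeffGraph π μ h) :=
    (isClosed_coeffGraph h).completeSpace_coe
  let ι : coeffGraph π μ h →L[ℂ] H :=
    (WithLp.fstL 2 ℂ H (Lp ℂ 2 μ)) ∘L (coeffGraph π μ h).subtypeL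
  have hι : ∀ p : coeffGraph π μ h, ι p = (p : WithLp 2 (H × Lp ℂ 2 μ)).fst := fun p => rfl
  let ιs : H →L[ℂ] coeffGraph π μ h := ContinuousLinearMap.adjoint ι
  have hadj : ∀ p u, inner ℂ p (ιs u) = inner ℂ (ι p) u := fun p u =>
    ContinuousLinearMap.adjoint_inner_right ι p u
  have hinner : ∀ p q : coeffGraph π μ h, inner ℂ p q = inner ℂ (ι p) (ι q) +
      ∫ x, π.coeff h (ι q) x * (starRingEnd ℂ) (π.coeff h (ι p) x) ∂μ := fun p q =>
    inner_coeffGraph p.2 q.2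
  have hmap : ∀ x (p : coeffGraph π μ h), ∃ q : coeffGraph π μ h, ι q = π x (ι p) := by
    intro x p
    obtain ⟨q, hq, e⟩ := exists_mem_coeffGraph (memLp_coeff_map x (memLp_of_mem_coeffGraph p.2))
    exact ⟨⟨q, hq⟩, e⟩
  -- `π x⁻¹` inverts `π x` only up to a phase, which is absorbed into `q`.
  have hmap' : ∀ x (p : coeffGraph π μ h), ∃ q : coeffGraph π μ h, π x (ι q) = ι p := by
    intro x p
    obtain ⟨σ, hσ⟩ := π.exists_cocycle'
    obtain ⟨q, hq⟩ := hmap x⁻¹ p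
    have h1 : π x (ι q) = ((σ x x⁻¹ : ℂ)⁻¹ * (σ 1 1 : ℂ)⁻¹) • ι p := by
      have e1 := hσ x x⁻¹ (ι p)
      have e2 := hσ 1 1 (ι p)
      rw [mul_one, ← map_smul] at e2
      have e3 := (π 1).injective e2
      rw [← hq, mul_inv_cancel] at e1
      rw [mul_smul]
      nth_rewrite 1 [e3]
      rw [smul_smul (σ 1 1 : ℂ)⁻¹, inv_mul_cancel₀ (Circle.coe_ne_zero _), one_smul, e1, smul_smul,
        inv_mul_cancel₀ (Circle.coe_ne_zero _), one_smul]
    refine ⟨((σ x x⁻¹ : ℂ)⁻¹ * (σ 1 1 : ℂ)⁻¹)⁻¹ • q, ?_⟩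
    rw [map_smul, map_smul, h1, smul_smul, inv_mul_cancel₀, one_smul]
    exact mul_ne_zero (inv_ne_zero (Circle.coe_ne_zero _)) (inv_ne_zero (Circle.coe_ne_zero _))
  -- The domain of V_h and the graph inner product are invariant under `π`, so `ι ∘L ιs` commutes
  -- with `π` and is a scalar. Density of the domain is not needed: a nonzero scalar already makes
  -- `ι` surjective.
  let R : H →L[ℂ] H := ι ∘L ιs
  have hRsa : IsSelfAdjoint R := by
    rw [ContinuousLinearMap.isSelfAdjoint_iff_isSymmetric]
    intro u v
    change inner ℂ (ι (ιs u)) v = inner ℂ u (ι (ιs v))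
    rw [← inner_conj_symm u, ← hadj (ιs u), ← hadj (ιs v)]
    exact (inner_conj_symm (ιs u) (ιs v)).symm
  have hRcomm : ∀ x u, R (π x u) = π x (R u) := by
    intro x u
    obtain ⟨w, hw⟩ := hmap x (ιs u)
    have : ιs (π x u) = w := by
      refine ext_inner_left ℂ fun p => ?_
      obtain ⟨q, hq⟩ := hmap' x p
      rw [hadj, hinner, hw, ← hq, LinearIsometryEquiv.inner_map_map,
        LinearIsometryEquiv.inner_map_map, integral_coeff_map_mul_conj, ← hinner, hadj]
    change ι (ιs (π x u)) = π x (ι (ιs u))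
    rw [this, hw]
  obtain ⟨r, hr⟩ := hπ.exists_eq_smul hRsa hRcomm
  have hR : ∀ u, ι (ιs u) = (r : ℂ) • u := by
    intro u
    have := congrArg (fun T : H →L[ℂ] H => T u) hr
    simpa [R] using this
  have hιinj : Function.Injective ι := by
    rw [injective_iff_map_eq_zero]
    intro p hp
    have : inner ℂ p p = (0 : ℂ) := by
      rw [hinner, hp]
      simp [coeff]
    exact inner_self_eq_zero.mp this
  have hr0 : (r : ℂ) ≠ 0 := by
    intro h0
    obtain ⟨p, hp, e⟩ := exists_mem_coeffGraph hmem
    have h1 : ιs f₀ = 0 := by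
      apply hιinj
      rw [hR, h0, zero_smul, map_zero]
    have h2 := hadj ⟨p, hp⟩ f₀
    rw [h1, inner_zero_right, hι] at h2
    simp only [e] at h2
    exact hf₀ (inner_self_eq_zero.mp h2.symm)
  have hsurj : ∀ f, ∃ p : coeffGraph π μ h, ι p = f := fun f =>
    ⟨(r : ℂ)⁻¹ • ιs f, by rw [map_smul, hR, smul_smul, inv_mul_cancel₀ hr0, one_smul]⟩
  -- Since `ιs ∘ ι` is also `r`, the squared graph norm ‖f‖² + ‖V_h f‖² equals r⁻¹‖f‖².
  refine ⟨r⁻¹ - 1, fun f => ?_⟩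
  obtain ⟨p, rfl⟩ := hsurj f
  refine ⟨memLp_of_mem_coeffGraph p.2, ?_⟩
  have h1 : ιs (ι p) = (r : ℂ) • p := by
    apply hιinj
    rw [hR, map_smul]
  have h2 := hadj p (ι p)
  have h5 : inner ℂ p ((r : ℂ) • p) = (r : ℂ) * inner ℂ p p := inner_smul_right p p (r : ℂ)
  have h6 : inner ℂ (ι p) (ι p) = ((‖ι p‖ ^ 2 : ℝ) : ℂ) := by
    simp
  rw [h1, h5, hinner, h6] at h2
  have h3 : ∫ x, π.coeff h (ι p) x * (starRingEnd ℂ) (π.coeff h (ι p) x) ∂μ =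
      ((∫ x, ‖π.coeff h (ι p) x‖ ^ 2 ∂μ : ℝ) : ℂ) := by
    rw [← integral_complex_ofReal]
    refine integral_congr_ae (Eventually.of_forall fun x => ?_)
    simp only [Complex.mul_conj, Complex.normSq_eq_norm_sq]
  rw [h3] at h2
  have h4 : r * (‖ι p‖ ^ 2 + ∫ x, ‖π.coeff h (ι p) x‖ ^ 2 ∂μ) = ‖ι p‖ ^ 2 := by exact_mod_cast h2
  have hr0' : r ≠ 0 := by exact_mod_cast hr0
  field_simp
  linarith

/-- Inversion exchanges |V_h g| and |V_g h|, so square-integrability passes from one window `h` to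
every window `g`. Comparing the two norms at `h` shows that the constant for `g` is proportional to
‖g‖². -/
theorem IsDiscreteSeries.exists_integral_norm_coeff_sq [μ.IsMulLeftInvariant] [μ.IsInvInvariant]
    (hπ : π.IsDiscreteSeries μ) :
    ∃ κ : ℝ, ∀ g f : H, MemLp (π.coeff g f) 2 μ ∧
      ∫ x, ‖π.coeff g f x‖ ^ 2 ∂μ = κ * (‖f‖ ^ 2 * ‖g‖ ^ 2) := by
  obtain ⟨h, h0, hh⟩ := hπ.squareIntegrable
  have hmem : MemLp (π.coeff h h) 2 μ := by
    refine ⟨(π.stronglyMeasurable_coeff h h).aestronglyMeasurable, ?_⟩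
    rw [eLpNorm_lt_top_iff_lintegral_rpow_enorm_lt_top (by norm_num) (by norm_num)]
    simpa using hh
  obtain ⟨C, hC⟩ := hπ.irreducible.exists_integral_norm_coeff_sq h0 hmem
  have hn : ‖h‖ ^ 2 ≠ 0 := by simpa using h0
  refine ⟨C / ‖h‖ ^ 2, fun g f => ?_⟩
  obtain ⟨C', hC'⟩ := hπ.irreducible.exists_integral_norm_coeff_sq (h := g) h0
    (memLp_coeff_swap (hC g).1)
  refine ⟨(hC' f).1, ?_⟩
  have e := (hC' h).2
  rw [integral_norm_coeff_sq_swap, (hC g).2] at e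
  rw [(hC' f).2]
  field_simp
  linear_combination -‖f‖ ^ 2 * e

/-- A sesquilinear form is determined by its quadratic form. -/
theorem eq_zero_of_sesquilinear_self {E : Type*} [AddCommGroup E] [Module ℂ E]
    (B : E → E → ℂ) (add_left : ∀ a b c, B (a + b) c = B a c + B b c)
    (add_right : ∀ a b c, B a (b + c) = B a b + B a c)
    (smul_left : ∀ (z : ℂ) a b, B (z • a) b = z * B a b)
    (smul_right : ∀ (z : ℂ) a b, B a (z • b) = (starRingEnd ℂ) z * B a b)
    (self : ∀ a, B a a = 0) (a b : E) : B a b = 0 := by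
  have h1 := self (a + b)
  have h2 := self (a + Complex.I • b)
  rw [add_left, add_right, add_right, self, self] at h1
  rw [add_left, add_right, add_right, self, smul_right, smul_left, smul_right, smul_left, self,
    Complex.conj_I] at h2
  linear_combination (1 / 2) * h1 + (Complex.I / 2) * h2 +
    ((B a b - B b a) / 2) * Complex.I_sq

end Orthogonality

section FormalDegree

variable {G H : Type*} [Group G] [TopologicalSpace G] [IsTopologicalGroup G]
  [LocallyCompactSpace G] [SecondCountableTopology G] [MeasurableSpace G] [BorelSpace G]
  [NormedAddCommGroup H] [InnerProductSpace ℂ H] [CompleteSpace H] {π : ProjUnitaryRep G H}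
  {μ : Measure G}

/-- The orthogonality relations for discrete series of unimodular groups. -/
theorem IsDiscreteSeries.exists_isFormalDegree [μ.IsHaarMeasure] [μ.IsMulRightInvariant]
    (hπ : π.IsDiscreteSeries μ) : ∃ d, π.IsFormalDegree μ d := by
  have := isInvInvariant_of_isMulRightInvariant μ
  obtain ⟨κ, hκ⟩ := hπ.exists_integral_norm_coeff_sq
  obtain ⟨h, h0, -⟩ := hπ.squareIntegrable
  have hκ0 : 0 < κ := by
    have hnn : 0 ≤ κ := by
      have h1 := (hκ h h).2
      have h2 : 0 ≤ ∫ x, ‖π.coeff h h x‖ ^ 2 ∂μ := integral_nonneg fun x => by positivity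
      rw [h1] at h2
      exact nonneg_of_mul_nonneg_left h2 (by positivity)
    refine lt_of_le_of_ne hnn fun hz => ?_
    -- `H` need not be separable, but the orbit of `h` is. If κ = 0, then for almost every x the
    -- vector π(x)h is orthogonal to a countable set whose closure contains the orbit, hence to
    -- itself.
    obtain ⟨c, hc, hcd⟩ := (π.stronglyMeasurable' h).isSeparable_range
    have hae : ∀ᵐ x ∂μ, ∀ u ∈ c, π.coeff h u x = 0 := by
      rw [ae_ball_iff hc]
      intro u _
      have h1 := (hκ h u).2
      rw [← hz, zero_mul, integral_eq_zero_iff_of_nonneg (fun x => by positivity)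
        ((π.memLp_coeff_iff h u).mp (hκ h u).1)] at h1
      filter_upwards [h1] with x hx
      simpa using hx
    obtain ⟨x, hx⟩ := hae.exists
    have hclosed : IsClosed {u : H | π.coeff h u x = 0} :=
      isClosed_eq (continuous_const.inner continuous_id) continuous_const
    have hmem : π x h ∈ {u : H | π.coeff h u x = 0} :=
      closure_minimal hx hclosed (hcd ⟨x, rfl⟩)
    have : π x h = 0 := inner_self_eq_zero.mp hmem
    exact h0 (by simpa using this)
  have hint : ∀ g₁ f₁ g₂ f₂, Integrable
      (fun x => π.coeff g₁ f₁ x * (starRingEnd ℂ) (π.coeff g₂ f₂ x)) μ := fun g₁ f₁ g₂ f₂ =>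
    (hκ g₁ f₁).1.integrable_mul (hκ g₂ f₂).1.star
  have hself : ∀ g f, ∫ x, π.coeff g f x * (starRingEnd ℂ) (π.coeff g f x) ∂μ =
      (κ : ℂ) * inner ℂ f f * (starRingEnd ℂ) (inner ℂ g g) := by
    intro g f
    have h1 : ∫ x, π.coeff g f x * (starRingEnd ℂ) (π.coeff g f x) ∂μ =
        ((∫ x, ‖π.coeff g f x‖ ^ 2 ∂μ : ℝ) : ℂ) := by
      rw [← integral_complex_ofReal]
      refine integral_congr_ae (Eventually.of_forall fun x => ?_)
      simp only [Complex.mul_conj, Complex.normSq_eq_norm_sq]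
    rw [h1, (hκ g f).2, inner_self_eq_norm_sq_to_K, inner_self_eq_norm_sq_to_K]
    simp
    ring
  -- Polarisation in f with g fixed; this is the diagonal case for the polarisation in g that
  -- follows.
  have hmid : ∀ g f₁ f₂, ∫ x, π.coeff g f₁ x * (starRingEnd ℂ) (π.coeff g f₂ x) ∂μ =
      (κ : ℂ) * inner ℂ f₂ f₁ * (starRingEnd ℂ) (inner ℂ g g) := by
    intro g f₁ f₂
    rw [← sub_eq_zero]
    refine eq_zero_of_sesquilinear_self (fun f₁ f₂ =>
      ∫ x, π.coeff g f₁ x * (starRingEnd ℂ) (π.coeff g f₂ x) ∂μ -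
        (κ : ℂ) * inner ℂ f₂ f₁ * (starRingEnd ℂ) (inner ℂ g g)) ?_ ?_ ?_ ?_ ?_ f₁ f₂
    · intro a b c
      simp only [coeff_add_right, Pi.add_apply, add_mul, inner_add_right]
      rw [integral_add (hint _ _ _ _) (hint _ _ _ _)]
      ring
    · intro a b c
      simp only [coeff_add_right, Pi.add_apply, map_add, mul_add, inner_add_left]
      rw [integral_add (hint _ _ _ _) (hint _ _ _ _)]
      ring
    · intro z a b
      simp only [coeff_smul_right, Pi.smul_apply, smul_eq_mul, mul_assoc, inner_smul_right]
      rw [integral_const_mul]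
      ring
    · intro z a b
      simp only [coeff_smul_right, Pi.smul_apply, smul_eq_mul, map_mul, inner_smul_left,
        mul_left_comm _ ((starRingEnd ℂ) z)]
      rw [integral_const_mul]
      ring
    · intro a
      simp only [hself, sub_self]
  refine ⟨κ⁻¹, inv_pos.mpr hκ0, fun f₁ f₂ g₁ g₂ => ?_⟩
  rw [Complex.ofReal_inv, inv_inv, ← sub_eq_zero]
  refine eq_zero_of_sesquilinear_self (fun g₂ g₁ =>
      ∫ x, π.coeff g₁ f₁ x * (starRingEnd ℂ) (π.coeff g₂ f₂ x) ∂μ -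
        (κ : ℂ) * inner ℂ f₂ f₁ * (starRingEnd ℂ) (inner ℂ g₂ g₁)) ?_ ?_ ?_ ?_ ?_ g₂ g₁
  · intro a b c
    simp only [coeff_add_left, Pi.add_apply, map_add, mul_add, inner_add_left]
    rw [integral_add (hint _ _ _ _) (hint _ _ _ _)]
    ring
  · intro a b c
    simp only [coeff_add_left, Pi.add_apply, map_add, mul_add, inner_add_right, add_mul]
    rw [integral_add (hint _ _ _ _) (hint _ _ _ _)]
    ring
  · intro z a b
    simp only [coeff_smul_left, Pi.smul_apply, smul_eq_mul, map_mul, inner_smul_left,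
      Complex.conj_conj, mul_left_comm _ z]
    rw [integral_const_mul]
    ring
  · intro z a b
    simp only [coeff_smul_left, Pi.smul_apply, smul_eq_mul, map_mul, inner_smul_right, mul_assoc,
      mul_left_comm _ ((starRingEnd ℂ) z)]
    rw [integral_const_mul]
    ring
  · intro a
    simp only [hmid, sub_self]

theorem IsDiscreteSeries.isFormalDegree_formalDegree [μ.IsHaarMeasure] [μ.IsMulRightInvariant]
    (hπ : π.IsDiscreteSeries μ) : π.IsFormalDegree μ (π.formalDegree μ) := by
  rw [formalDegree, dif_pos hπ.exists_isFormalDegree]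
  exact hπ.exists_isFormalDegree.choose_spec

end FormalDegree

end ProjUnitaryRep

/-! ### Frames: reconstruction and removal of a sparse infinite subfamily -/

section Frames

variable {ι H : Type*} [NormedAddCommGroup H] [InnerProductSpace ℂ H] {v : ι → H}

theorem inner_mul_inner_symm (a b : H) :
    inner ℂ a b * inner ℂ b a = ((‖inner ℂ b a‖ ^ 2 : ℝ) : ℂ) := by
  rw [← inner_conj_symm, ← Complex.normSq_eq_norm_sq, mul_comm, Complex.mul_conj]

/-- The inverse `R` of the frame operator, characterised by the reconstruction formula
`f = ∑ ⟨R f, v i⟩ v i` in weak form. -/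
theorem IsFrame.exists_reconstruction [CompleteSpace H] (hv : IsFrame v) :
    ∃ R : H →L[ℂ] H, (∀ f f', inner ℂ (R f) f' = inner ℂ f (R f')) ∧
      ∀ f f', HasSum (fun i => inner ℂ f (v i) * inner ℂ (v i) (R f')) (inner ℂ f f') := by
  obtain ⟨A, B, hA, hB, hAB⟩ := hv
  have hmem : ∀ f, Memℓp (fun i => inner ℂ (v i) f) 2 := by
    intro f
    refine memℓp_gen ?_
    simpa using (hAB f).1
  have hnorm : ∀ f, ‖(⟨_, hmem f⟩ : lp (fun _ : ι => ℂ) 2)‖ ^ 2 =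
      ∑' i, ‖inner ℂ (v i) f‖ ^ 2 := by
    intro f
    have := lp.norm_rpow_eq_tsum (p := 2) (by norm_num) (⟨_, hmem f⟩ : lp (fun _ : ι => ℂ) 2)
    simpa using this
  let T₀ : H →ₗ[ℂ] lp (fun _ : ι => ℂ) 2 :=
    { toFun := fun f => ⟨_, hmem f⟩
      map_add' := by
        intro f f'
        ext i
        exact inner_add_right _ _ _
      map_smul' := by
        intro c f
        ext i
        simp }
  let T : H →L[ℂ] lp (fun _ : ι => ℂ) 2 := T₀.mkContinuous (Real.sqrt B) (by
    intro f
    refine le_of_sq_le_sq ?_ (by positivity)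
    rw [mul_pow, Real.sq_sqrt hB.le]
    exact (hnorm f).trans_le (hAB f).2.2)
  have hT : ∀ f i, T f i = inner ℂ (v i) f := fun f i => rfl
  let S : H →L[ℂ] H := (ContinuousLinearMap.adjoint T) ∘L T
  have hS : ∀ f f', inner ℂ f (S f') = inner ℂ (T f) (T f') := fun f f' =>
    ContinuousLinearMap.adjoint_inner_right T f (T f')
  have hS' : ∀ f f', inner ℂ (S f) f' = inner ℂ (T f) (T f') := fun f f' =>
    ContinuousLinearMap.adjoint_inner_left T f' (T f)
  have hunit : IsUnit S := by
    refine ContinuousLinearMap.isUnit_of_forall_le_norm_inner_map S (c := ⟨A, hA.le⟩) hA ?_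
    intro f
    rw [hS', inner_self_eq_norm_sq_to_K]
    have h1 : ‖T f‖ ^ 2 = ∑' i, ‖inner ℂ (v i) f‖ ^ 2 := hnorm f
    have h2 := (hAB f).2.1
    have : ‖((‖T f‖ : ℂ)) ^ 2‖ = ‖T f‖ ^ 2 := by simp
    refine le_trans ?_ this.ge
    rw [h1]
    change ‖f‖ ^ 2 * A ≤ _
    linarith
  obtain ⟨u, hu⟩ := hunit
  have hSR : ∀ f, S ((↑u⁻¹ : H →L[ℂ] H) f) = f := by
    intro f
    have := u.mul_inv
    rw [hu] at this
    exact congrArg (fun L : H →L[ℂ] H => L f) this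
  refine ⟨(↑u⁻¹ : H →L[ℂ] H), fun f f' => ?_, fun f f' => ?_⟩
  · conv_lhs => rw [← hSR f', hS, ← hS', hSR]
  · have h := lp.hasSum_inner (𝕜 := ℂ) (T f) (T ((↑u⁻¹ : H →L[ℂ] H) f'))
    rw [← hS, hSR] at h
    refine h.congr_fun fun i => ?_
    rw [hT, hT, RCLike.inner_apply, inner_conj_symm, mul_comm]

variable {R : H →L[ℂ] H}

theorem hasSum_norm_inner_sq_of_reconstruction
    (hR : ∀ f f', inner ℂ (R f) f' = inner ℂ f (R f'))
    (hsum : ∀ f f', HasSum (fun i => inner ℂ f (v i) * inner ℂ (v i) (R f')) (inner ℂ f f'))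
    (w : H) : HasSum (fun i => ‖inner ℂ (v i) (R w)‖ ^ 2) (inner ℂ w (R w)).re := by
  have h := hsum (R w) w
  rw [hR] at h
  simp_rw [inner_mul_inner_symm] at h
  simpa only [Complex.ofReal_re] using Complex.hasSum_re h

/-- Write X for the sum on the left and Y for the sum over all i. For w = ∑ ⟨u_n, f⟩ u_n one has ⟨f,
w⟩ = X; reconstruction and the weighted arithmetic-geometric inequality give X ≤ (βY + β⁻¹⟨w,
Rw⟩)/2, and the Gram bound gives ⟨w, Rw⟩ ≤ βX. -/
theorem sum_norm_inner_sq_le_of_gram_bound {κ : Type*} {f : H}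
    (hR : ∀ f f', inner ℂ (R f) f' = inner ℂ f (R f'))
    (hsum : ∀ f f', HasSum (fun i => inner ℂ f (v i) * inner ℂ (v i) (R f')) (inner ℂ f f'))
    (hf : Summable fun i => ‖inner ℂ (v i) f‖ ^ 2) (u : κ → H) (s : Finset κ) {β : ℝ} (hβ : 0 < β)
    (hgram : ∀ a : κ → ℂ, (inner ℂ (∑ n ∈ s, a n • u n) (R (∑ n ∈ s, a n • u n))).re ≤
      β * ∑ n ∈ s, ‖a n‖ ^ 2) :
    ∑ n ∈ s, ‖inner ℂ (u n) f‖ ^ 2 ≤ β * ∑' i, ‖inner ℂ (v i) f‖ ^ 2 := by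
  set w := ∑ n ∈ s, (inner ℂ (u n) f : ℂ) • u n with hw
  have h1 : inner ℂ f w = ((∑ n ∈ s, ‖inner ℂ (u n) f‖ ^ 2 : ℝ) : ℂ) := by
    rw [hw, inner_sum, Complex.ofReal_sum]
    refine Finset.sum_congr rfl fun n _ => ?_
    rw [inner_smul_right, mul_comm, inner_mul_inner_symm]
  have h2 := Complex.hasSum_re (hsum f w)
  rw [h1, Complex.ofReal_re] at h2
  have hW := hasSum_norm_inner_sq_of_reconstruction hR hsum w
  have h3 : HasSum (fun i => (β * ‖inner ℂ (v i) f‖ ^ 2 + β⁻¹ * ‖inner ℂ (v i) (R w)‖ ^ 2) / 2)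
      ((β * ∑' i, ‖inner ℂ (v i) f‖ ^ 2 + β⁻¹ * (inner ℂ w (R w)).re) / 2) :=
    ((hf.hasSum.mul_left β).add (hW.mul_left β⁻¹)).div_const 2
  have h4 := hasSum_le (fun i => ?_) h2 h3
  · have h5 := hgram fun n => inner ℂ (u n) f
    rw [← hw] at h5
    have h6 : β⁻¹ * (inner ℂ w (R w)).re ≤ ∑ n ∈ s, ‖inner ℂ (u n) f‖ ^ 2 := by
      rw [inv_mul_le_iff₀ hβ]
      exact h5
    linarith
  · refine (Complex.re_le_norm _).trans ?_
    rw [norm_mul, norm_inner_symm]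
    have h7 : 0 ≤ β⁻¹ * (β * ‖inner ℂ (v i) f‖ - ‖inner ℂ (v i) (R w)‖) ^ 2 := by positivity
    have h8 : β⁻¹ * (β * ‖inner ℂ (v i) f‖ - ‖inner ℂ (v i) (R w)‖) ^ 2 =
        β * ‖inner ℂ (v i) f‖ ^ 2 + β⁻¹ * ‖inner ℂ (v i) (R w)‖ ^ 2 -
          2 * (‖inner ℂ (v i) f‖ * ‖inner ℂ (v i) (R w)‖) := by
      field_simp
      ring
    linarith

/-- The off-diagonal part is dominated entrywise by the rank-one matrix (c_m c_n), whose norm is ∑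
c_n² by Cauchy-Schwarz. -/
theorem re_inner_sum_le_of_off_diagonal {κ : Type*} (u : κ → H) (s : Finset κ) {α δ : ℝ}
    (c : κ → ℝ)
    (hdiag : ∀ n, (inner ℂ (u n) (R (u n))).re ≤ α)
    (hoff : ∀ m n, m ≠ n → ‖inner ℂ (u m) (R (u n))‖ ≤ c m * c n)
    (hδ : ∑ n ∈ s, c n ^ 2 ≤ δ) (a : κ → ℂ) :
    (inner ℂ (∑ n ∈ s, a n • u n) (R (∑ n ∈ s, a n • u n))).re ≤
      (α + δ) * ∑ n ∈ s, ‖a n‖ ^ 2 := by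
  classical
  have hexp : inner ℂ (∑ n ∈ s, a n • u n) (R (∑ n ∈ s, a n • u n)) =
      ∑ m ∈ s, ∑ n ∈ s, (starRingEnd ℂ) (a m) * (a n) * inner ℂ (u m) (R (u n)) := by
    rw [map_sum, sum_inner]
    refine Finset.sum_congr rfl fun m _ => ?_
    rw [inner_sum]
    refine Finset.sum_congr rfl fun n _ => ?_
    rw [map_smul, inner_smul_left, inner_smul_right, mul_assoc]
  have hterm : ∀ m n, ((starRingEnd ℂ) (a m) * (a n) * inner ℂ (u m) (R (u n))).re ≤
      (if m = n then α * ‖a m‖ ^ 2 else 0) + (c m * ‖a m‖) * (c n * ‖a n‖) := by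
    intro m n
    split_ifs with h
    · subst h
      rw [mul_comm ((starRingEnd ℂ) (a m)), Complex.mul_conj, Complex.re_ofReal_mul,
        Complex.normSq_eq_norm_sq]
      have h1 := mul_le_mul_of_nonneg_left (hdiag m) (sq_nonneg ‖a m‖)
      have h2 : 0 ≤ (c m * ‖a m‖) * (c m * ‖a m‖) := mul_self_nonneg _
      linarith
    · refine (Complex.re_le_norm _).trans ?_
      rw [norm_mul, norm_mul, RCLike.norm_conj, zero_add]
      have := mul_le_mul_of_nonneg_left (hoff m n h) (by positivity : 0 ≤ ‖a m‖ * ‖a n‖)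
      linarith
  rw [hexp, Complex.re_sum]
  simp_rw [Complex.re_sum]
  calc ∑ m ∈ s, ∑ n ∈ s, ((starRingEnd ℂ) (a m) * (a n) * inner ℂ (u m) (R (u n))).re
      ≤ ∑ m ∈ s, ∑ n ∈ s, ((if m = n then α * ‖a m‖ ^ 2 else 0) +
          (c m * ‖a m‖) * (c n * ‖a n‖)) :=
        Finset.sum_le_sum fun m _ => Finset.sum_le_sum fun n _ => hterm m n
    _ = α * ∑ m ∈ s, ‖a m‖ ^ 2 + (∑ m ∈ s, c m * ‖a m‖) ^ 2 := by
        simp_rw [Finset.sum_add_distrib]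
        rw [sq, Finset.sum_mul_sum, Finset.mul_sum]
        congr 1
        refine Finset.sum_congr rfl fun m hm => ?_
        rw [Finset.sum_ite_eq, if_pos hm]
    _ ≤ α * ∑ m ∈ s, ‖a m‖ ^ 2 + (∑ m ∈ s, c m ^ 2) * ∑ m ∈ s, ‖a m‖ ^ 2 := by
        gcongr
        exact Finset.sum_mul_sq_le_sq_mul_sq s c fun m => ‖a m‖
    _ ≤ (α + δ) * ∑ n ∈ s, ‖a n‖ ^ 2 := by
        rw [add_mul]
        gcongr

theorem exists_sparse_sequence {J : Set ι} (hJ : J.Infinite) (P : ι → ι → ℝ)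
    (hP : ∀ i, Tendsto (P i) cofinite (𝓝 0)) {ε : ℕ → ℝ} (hε : ∀ n, 0 < ε n) (hanti : Antitone ε) :
    ∃ e : ℕ → ι, Function.Injective e ∧ (∀ n, e n ∈ J) ∧ ∀ m n, m < n → P (e m) (e n) ≤ ε n := by
  classical
  -- The second component is a strictly increasing counter. It is at least `n` at the n-th step, so
  -- antitonicity turns the bound at the counter into `ε n`.
  obtain ⟨f, hf1, hf2⟩ := exists_seq_of_forall_finset_exists (α := ι × ℕ) (fun p => p.1 ∈ J)
    (fun p q => p.1 ≠ q.1 ∧ p.2 < q.2 ∧ P p.1 q.1 ≤ ε q.2) (by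
      intro s _
      let l := s.sup Prod.snd + 1
      have hev : ∀ᶠ j in cofinite, ∀ p ∈ s, P p.1 j ≤ ε l ∧ p.1 ≠ j := by
        rw [Filter.eventually_all_finset]
        intro p _
        refine ((hP p.1).eventually_le_const (hε l)).and ?_
        rw [Filter.eventually_cofinite]
        exact (Set.finite_singleton p.1).subset fun x hx => by
          simpa [eq_comm] using hx
      obtain ⟨j, hj, hjJ⟩ := (hJ.frequently_cofinite.and_eventually hev).exists
      refine ⟨(j, l), hj, fun p hp => ⟨(hjJ p hp).2, ?_, (hjJ p hp).1⟩⟩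
      exact Nat.lt_succ_of_le (Finset.le_sup (f := Prod.snd) hp))
  have hmono : StrictMono fun n => (f n).2 := fun m n h => (hf2 m n h).2.1
  refine ⟨fun n => (f n).1, ?_, hf1, fun m n h => ?_⟩
  · intro m n h
    by_contra hne
    rcases lt_or_gt_of_ne hne with h' | h'
    · exact (hf2 m n h').1 h
    · exact (hf2 n m h').1 h.symm
  · exact (hf2 m n h).2.2.trans (hanti (hmono.id_le n))

/-- If infinitely many vectors of a frame have `⟨v i, R v i⟩` bounded away from `1`, where `R` is
the inverse of the frame operator, then an infinite set of them can be removed. -/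
theorem IsFrame.exists_infinite_compl (hv : IsFrame v)
    (hR : ∀ f f', inner ℂ (R f) f' = inner ℂ f (R f'))
    (hsum : ∀ f f', HasSum (fun i => inner ℂ f (v i) * inner ℂ (v i) (R f')) (inner ℂ f f'))
    {J : Set ι} (hJ : J.Infinite) {α : ℝ} (hα : α < 1)
    (hdiag : ∀ i ∈ J, (inner ℂ (v i) (R (v i))).re ≤ α) :
    ∃ Γ ⊆ J, Γ.Infinite ∧ IsFrame (fun i : (Γᶜ : Set ι) => v i) := by
  obtain ⟨A, B, hA, hB, hAB⟩ := hv
  have hα0 : 0 ≤ α := by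
    obtain ⟨i, hi⟩ := hJ.nonempty
    exact ((hasSum_norm_inner_sq_of_reconstruction hR hsum (v i)).nonneg
      fun j => by positivity).trans (hdiag i hi)
  set κ := (1 - α) / 2 with hκ
  have hκ0 : 0 < κ := by rw [hκ]; linarith
  have hsymm : ∀ a b, ‖inner ℂ a (R b)‖ = ‖inner ℂ b (R a)‖ := by
    intro a b
    rw [← hR, norm_inner_symm]
  obtain ⟨e, he, heJ, hoff⟩ := exists_sparse_sequence hJ (fun i j => ‖inner ℂ (v i) (R (v j))‖)
    (fun i => by
      -- For fixed i the numbers ⟨v_j, R v_i⟩ are square summable in j.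
      have h1 := (hAB (R (v i))).1.tendsto_cofinite_zero
      have h2 := h1.sqrt
      rw [Real.sqrt_zero] at h2
      refine h2.congr fun j => ?_
      rw [Real.sqrt_sq (norm_nonneg _), hsymm])
    -- For m < n this is at most c_m c_n with c_n = κ 2^(-(n+1)), and ∑ c_n² = κ²/3. The Gram bound
    -- becomes α + κ², which is below 1 because κ = (1 - α)/2 ≤ 1/2.
    (ε := fun n => κ ^ 2 * (1 / 4) ^ (n + 1)) (fun n => by positivity)
    (fun m n h => by
      have : ((1 : ℝ) / 4) ^ (n + 1) ≤ (1 / 4) ^ (m + 1) :=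
        pow_le_pow_of_le_one (by norm_num) (by norm_num) (by omega)
      exact mul_le_mul_of_nonneg_left this (by positivity))
  have hkey : ∀ f s, ∑ n ∈ s, ‖inner ℂ (v (e n)) f‖ ^ 2 ≤
      (α + κ ^ 2) * ∑' i, ‖inner ℂ (v i) f‖ ^ 2 := by
    intro f s
    refine sum_norm_inner_sq_le_of_gram_bound hR hsum (hAB f).1 (fun n => v (e n)) s
      (by positivity) ?_
    have hlt : ∀ m n, m < n → ‖inner ℂ (v (e m)) (R (v (e n)))‖ ≤
        (κ * (1 / 2) ^ (m + 1)) * (κ * (1 / 2) ^ (n + 1)) := by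
      intro m n h
      refine (hoff m n h).trans ?_
      have h1 : ((1 : ℝ) / 4) ^ (n + 1) ≤ (1 / 2) ^ (m + 1) * (1 / 2) ^ (n + 1) := by
        have : (1 : ℝ) / 4 = 1 / 2 * (1 / 2) := by norm_num
        rw [this, mul_pow]
        gcongr ?_ * _
        exact pow_le_pow_of_le_one (by norm_num) (by norm_num) (by omega)
      have := mul_le_mul_of_nonneg_left h1 (sq_nonneg κ)
      linarith
    refine re_inner_sum_le_of_off_diagonal (fun n => v (e n)) s (fun n => κ * (1 / 2) ^ (n + 1))
      (fun n => hdiag _ (heJ n)) (fun m n h => ?_) ?_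
    · rcases lt_or_gt_of_ne h with h' | h'
      · exact hlt m n h'
      · rw [hsymm, mul_comm]
        exact hlt n m h'
    · have h1 : HasSum (fun n : ℕ => κ ^ 2 * (1 / 4) * (1 / 4) ^ n)
          (κ ^ 2 * (1 / 4) * (1 - 1 / 4)⁻¹) :=
        (hasSum_geometric_of_lt_one (by norm_num) (by norm_num)).mul_left _
      have h2 : ∀ n : ℕ, (κ * (1 / 2) ^ (n + 1)) ^ 2 = κ ^ 2 * (1 / 4) * (1 / 4) ^ n := by
        intro n
        have : (1 : ℝ) / 4 = (1 / 2) ^ 2 := by norm_num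
        rw [this, ← pow_mul]
        ring
      simp_rw [h2]
      refine (sum_le_hasSum s (fun n _ => by positivity) h1).trans ?_
      have := sq_nonneg κ
      norm_num
      linarith
  have hβ : α + κ ^ 2 < 1 := by
    have : κ ^ 2 ≤ κ := by
      rw [sq]
      exact mul_le_of_le_one_left hκ0.le (by rw [hκ]; linarith)
    have : α + κ < 1 := by rw [hκ]; linarith
    linarith
  refine ⟨range e, range_subset_iff.mpr heJ, infinite_range_of_injective he,
    (1 - (α + κ ^ 2)) * A, B, mul_pos (by linarith) hA, hB, fun f => ?_⟩
  obtain ⟨hs, hlow, hup⟩ := hAB f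
  have hsplit := hs.tsum_subtype_add_tsum_subtype_compl (range e)
  rw [tsum_range (fun i => ‖inner ℂ (v i) f‖ ^ 2) he] at hsplit
  have h1 : ∑' n, ‖inner ℂ (v (e n)) f‖ ^ 2 ≤ (α + κ ^ 2) * ∑' i, ‖inner ℂ (v i) f‖ ^ 2 :=
    Real.tsum_le_of_sum_le (fun n => by positivity) (hkey f)
  have h0 : 0 ≤ ∑' n, ‖inner ℂ (v (e n)) f‖ ^ 2 := tsum_nonneg fun n => by positivity
  refine ⟨hs.subtype _, ?_, ?_⟩
  · have h2 := mul_le_mul_of_nonneg_left hlow (by linarith : 0 ≤ 1 - (α + κ ^ 2))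
    linarith
  · linarith

theorem IsFrame.comp_equiv {κ : Type*} (hv : IsFrame v) (e : κ ≃ ι) : IsFrame (v ∘ e) := by
  obtain ⟨A, B, hA, hB, hAB⟩ := hv
  refine ⟨A, B, hA, hB, fun f => ?_⟩
  have h := hAB f
  refine ⟨(e.summable_iff (f := fun i => ‖inner ℂ (v i) f‖ ^ 2)).mpr h.1, ?_⟩
  have he : ∑' k, ‖inner ℂ ((v ∘ e) k) f‖ ^ 2 = ∑' i, ‖inner ℂ (v i) f‖ ^ 2 :=
    e.tsum_eq fun i => ‖inner ℂ (v i) f‖ ^ 2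
  rw [he]
  exact h.2

end Frames

/-! ### Compact tails and the local maximal function -/

section CompactTails

variable {X : Type*} [TopologicalSpace X] [SigmaCompactSpace X]
  [MeasurableSpace X] {μ : Measure X}

theorem exists_isCompact_setLIntegral_ne_zero {f : X → ℝ≥0∞} (hf : ∫⁻ x, f x ∂μ ≠ 0) :
    ∃ C : Set X, IsCompact C ∧ ∫⁻ x in C, f x ∂μ ≠ 0 := by
  by_contra! h
  apply hf
  rw [← setLIntegral_univ, ← iUnion_compactCovering]
  refine le_antisymm ((lintegral_iUnion_le _ _).trans ?_) bot_le
  simp [h _ (isCompact_compactCovering X _)]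

variable [T2Space X] [BorelSpace X]

theorem exists_isCompact_setLIntegral_compl_le {f : X → ℝ≥0∞} (hf : ∫⁻ x, f x ∂μ ≠ ∞)
    {ε : ℝ≥0∞} (hε : ε ≠ 0) : ∃ C : Set X, IsCompact C ∧ ∫⁻ x in Cᶜ, f x ∂μ ≤ ε := by
  have hm : ∀ n, MeasurableSet (compactCovering X n) := fun n =>
    (isCompact_compactCovering X n).measurableSet
  have h : Tendsto ((μ.withDensity f) ∘ fun n => (compactCovering X n)ᶜ) atTop
      (𝓝 ((μ.withDensity f) (⋂ n, (compactCovering X n)ᶜ))) := by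
    refine tendsto_measure_iInter_atTop (fun n => (hm n).compl.nullMeasurableSet) ?_ ⟨0, ?_⟩
    · intro m n hmn
      exact compl_subset_compl.mpr (compactCovering_subset X hmn)
    · rw [withDensity_apply _ (hm 0).compl]
      exact ne_top_of_le_ne_top hf (setLIntegral_le_lintegral _ _)
  rw [← compl_iUnion, iUnion_compactCovering, compl_univ, measure_empty] at h
  obtain ⟨n, hn⟩ := (h.eventually_le_const (pos_iff_ne_zero.mpr hε)).exists
  refine ⟨_, isCompact_compactCovering X n, ?_⟩
  rw [Function.comp_apply, withDensity_apply _ (hm n).compl] at hn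
  exact hn

end CompactTails

section LocalMax

variable {G : Type*} [Group G] [TopologicalSpace G] [IsTopologicalGroup G]
  [SecondCountableTopology G] [T2Space G] [LocallyCompactSpace G]
  [MeasurableSpace G] [BorelSpace G]
  {μ : Measure G} [μ.IsHaarMeasure] [μ.IsMulRightInvariant]

/-- A function in the amalgam space `W^L(L²)` is, almost everywhere, dominated by local averages of
an integrable function. -/
theorem MemAmalgam.exists_local_average_bound {Q : Set G} (hQ : IsCompact Q) (hQs : Q⁻¹ = Q)
    {F : G → ℂ} (hF : Measurable F) (hFQ : MemAmalgam μ Q 2 F) :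
    ∃ m : G → ℝ≥0∞, Measurable m ∧ ∫⁻ z, m z ∂μ ≠ ∞ ∧
      ∀ᵐ w ∂μ, μ Q * ‖F w‖ₑ ^ 2 ≤ ∫⁻ q in Q, m (w * q) ∂μ := by
  have := isInvInvariant_of_isMulRightInvariant μ
  obtain ⟨hM, hM2⟩ := hFQ.2
  have hMm : AEMeasurable (localMax μ Q F) μ := hM.aemeasurable
  set M' := hMm.mk
  have hM'm : Measurable M' := hMm.measurable_mk
  have hM'e : localMax μ Q F =ᵐ[μ] M' := hMm.ae_eq_mk
  refine ⟨fun z => M' z ^ 2, hM'm.pow_const 2, ?_, ?_⟩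
  · rw [eLpNorm_lt_top_iff_lintegral_rpow_enorm_lt_top (by norm_num) (by norm_num)] at hM2
    refine ne_of_lt (lt_of_le_of_lt (le_of_eq ?_) hM2)
    refine lintegral_congr_ae ?_
    filter_upwards [hM'e] with z hz
    rw [hz]
    simp
  -- Exchanging the order of z and q allows the substitution w = zq for fixed q, which preserves
  -- null sets by right invariance. Exchanging back gives |F(w)| ≤ M'(wq⁻¹) for almost every q in
  -- `Q`, ready to be squared and integrated.
  have h1 : ∀ᵐ z ∂μ, ∀ᵐ q ∂(μ.restrict Q), ‖F (z * q)‖ₑ ≤ M' z := by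
    filter_upwards [hM'e] with z hz
    rw [← hz]
    exact ENNReal.ae_le_essSup (fun q => ‖F (z * q)‖ₑ)
  rw [Measure.ae_ae_comm (p := fun z q => ‖F (z * q)‖ₑ ≤ M' z)
    (measurableSet_le (hF.comp measurable_mul).enorm (hM'm.comp measurable_fst))] at h1
  have h2 : ∀ᵐ q ∂(μ.restrict Q), ∀ᵐ w ∂μ, ‖F w‖ₑ ≤ M' (w * q⁻¹) := by
    filter_upwards [h1] with q hq
    have := (measurePreserving_mul_right μ q⁻¹).quasiMeasurePreserving.ae hq
    simpa using this
  rw [Measure.ae_ae_comm (p := fun q w => ‖F w‖ₑ ≤ M' (w * q⁻¹))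
    (measurableSet_le (hF.comp measurable_snd).enorm
      (hM'm.comp (measurable_snd.mul measurable_fst.inv)))] at h2
  filter_upwards [h2] with w hw
  calc μ Q * ‖F w‖ₑ ^ 2 = ∫⁻ q in Q, ‖F w‖ₑ ^ 2 ∂μ := by
        rw [setLIntegral_const, mul_comm]
    _ ≤ ∫⁻ q in Q, M' (w * q⁻¹) ^ 2 ∂μ := by
        refine lintegral_mono_ae ?_
        filter_upwards [hw] with q hq
        gcongr
    _ = ∫⁻ q in Q, M' (w * q) ^ 2 ∂μ := by
        rw [← lintegral_indicator hQ.measurableSet, ← lintegral_indicator hQ.measurableSet,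
          ← lintegral_inv_eq_self]
        congr 1
        funext q
        have : q⁻¹ ∈ Q ↔ q ∈ Q := by rw [← Set.mem_inv, hQs]
        by_cases hq : q ∈ Q
        · rw [indicator_of_mem hq, indicator_of_mem (this.mpr hq), inv_inv]
        · rw [indicator_of_notMem hq, indicator_of_notMem (this.not.mpr hq)]

theorem tsum_indicator_one_eq_encard {X : Type*} (S T : Set X) :
    ∑' x : S, T.indicator (fun _ => (1 : ℝ≥0∞)) (x : X) = ((S ∩ T).encard : ℝ≥0∞) := by
  rw [tsum_subtype S (T.indicator fun _ => (1 : ℝ≥0∞)), indicator_indicator,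
    ← tsum_subtype (S ∩ T) fun _ => (1 : ℝ≥0∞), ENNReal.tsum_set_one]

/-- Uniform smallness of the tails `∑_{l ∉ x C} |F (x⁻¹ l)|²` for `F` in the amalgam space. -/
theorem MemAmalgam.exists_isCompact_tail_le {Q : Set G} (hQ : IsCompact Q) (hQs : Q⁻¹ = Q)
    (hQ1 : Q ∈ 𝓝 (1 : G)) {F : G → ℂ} (hF : Measurable F) (hFQ : MemAmalgam μ Q 2 F)
    {Λ : Set G} [Countable Λ] {N : ℕ} (hN : ∀ y : G, (Λ ∩ y • Q).encard ≤ N)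
    {η : ℝ} (hη : 0 < η) :
    ∃ C : Set G, IsCompact C ∧ ∀ᵐ x ∂μ, ∀ s : Finset Λ, (∀ l ∈ s, (l : G) ∉ x • C) →
      ∑ l ∈ s, ‖F (x⁻¹ * l)‖ ^ 2 ≤ η := by
  have := isInvInvariant_of_isMulRightInvariant μ
  obtain ⟨m, hm, hmi, hmae⟩ := hFQ.exists_local_average_bound hQ hQs hF
  have hQ0 : μ Q ≠ 0 := (Measure.measure_pos_of_mem_nhds μ hQ1).ne'
  have hQt : μ Q ≠ ∞ := hQ.measure_lt_top.ne
  -- `N + 1` keeps the denominator nonzero when `N = 0`.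
  set δ : ℝ≥0∞ := μ Q * ENNReal.ofReal η / (N + 1) with hδ
  have hδ0 : δ ≠ 0 := by
    refine ENNReal.div_ne_zero.mpr ⟨mul_ne_zero hQ0 (by simpa using hη), ?_⟩
    exact ENNReal.add_ne_top.mpr ⟨ENNReal.natCast_ne_top N, ENNReal.one_ne_top⟩
  obtain ⟨C, hC, hCδ⟩ := exists_isCompact_setLIntegral_compl_le hmi hδ0
  refine ⟨C * Q, hC.mul hQ, ?_⟩
  have hgood : ∀ᵐ x ∂μ, ∀ l : Λ, μ Q * ‖F (x⁻¹ * l)‖ₑ ^ 2 ≤ ∫⁻ q in Q, m (x⁻¹ * l * q) ∂μ := by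
    rw [ae_all_iff]
    intro l
    have h1 := (measurePreserving_mul_right μ (l : G)).quasiMeasurePreserving.ae hmae
    exact (Measure.measurePreserving_inv μ).quasiMeasurePreserving.ae h1
  filter_upwards [hgood] with x hx s hs
  -- Each term is at most the integral of m over x⁻¹lQ. These sets overlap at most `N` times, and
  -- they miss `C` because l ∉ xCQ and `Q` is symmetric.
  have hkey : μ Q * ∑ l ∈ s, ‖F (x⁻¹ * l)‖ₑ ^ 2 ≤ μ Q * ENNReal.ofReal η := by
    calc μ Q * ∑ l ∈ s, ‖F (x⁻¹ * l)‖ₑ ^ 2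
        = ∑ l ∈ s, μ Q * ‖F (x⁻¹ * l)‖ₑ ^ 2 := Finset.mul_sum _ _ _
      _ ≤ ∑ l ∈ s, ∫⁻ q in Q, m (x⁻¹ * l * q) ∂μ := Finset.sum_le_sum fun l _ => hx l
      _ = ∑ l ∈ s, ∫⁻ z, Q.indicator (fun _ => (1 : ℝ≥0∞)) ((x⁻¹ * l)⁻¹ * z) * m z ∂μ := by
          refine Finset.sum_congr rfl fun l _ => ?_
          rw [← lintegral_indicator hQ.measurableSet, ← lintegral_mul_left_eq_self (fun z =>
            Q.indicator (fun _ => (1 : ℝ≥0∞)) ((x⁻¹ * l)⁻¹ * z) * m z) (x⁻¹ * (l : G))]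
          congr 1
          funext q
          rw [inv_mul_cancel_left]
          by_cases hq : q ∈ Q
          · simp [indicator_of_mem hq]
          · simp [indicator_of_notMem hq]
      _ = ∫⁻ z, ∑ l ∈ s, Q.indicator (fun _ => (1 : ℝ≥0∞)) ((x⁻¹ * l)⁻¹ * z) * m z ∂μ := by
          refine (lintegral_finsetSum _ fun l _ => Measurable.mul ?_ hm).symm
          exact (measurable_const.indicator hQ.measurableSet).comp (measurable_const_mul _)
      _ ≤ ∫⁻ z, Cᶜ.indicator (fun z => (N : ℝ≥0∞) * m z) z ∂μ := by
          refine lintegral_mono fun z => ?_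
          simp only
          rw [← Finset.sum_mul]
          by_cases hz : z ∈ C
          · rw [indicator_of_notMem (by simpa using hz)]
            refine le_of_eq (mul_eq_zero_of_left (Finset.sum_eq_zero fun l hl => ?_) _)
            refine indicator_of_notMem (fun hmem => hs l hl ?_) _
            have h2 : ((x⁻¹ * (l : G))⁻¹ * z)⁻¹ ∈ Q := by rwa [← Set.mem_inv, hQs]
            refine ⟨z * ((x⁻¹ * (l : G))⁻¹ * z)⁻¹, Set.mul_mem_mul hz h2, ?_⟩
            simp only [smul_eq_mul]
            group
          · rw [indicator_of_mem (by simpa using hz)]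
            gcongr
            calc ∑ l ∈ s, Q.indicator (fun _ => (1 : ℝ≥0∞)) ((x⁻¹ * l)⁻¹ * z)
                ≤ ∑ l ∈ s, ((x * z) • Q).indicator (fun _ => (1 : ℝ≥0∞)) (l : G) := by
                  refine Finset.sum_le_sum fun l _ => ?_
                  by_cases hq : (x⁻¹ * (l : G))⁻¹ * z ∈ Q
                  · have h2 : ((x⁻¹ * (l : G))⁻¹ * z)⁻¹ ∈ Q := by rwa [← Set.mem_inv, hQs]
                    have h3 : (l : G) ∈ (x * z) • Q := by
                      refine ⟨_, h2, ?_⟩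
                      simp only [smul_eq_mul]
                      group
                    rw [indicator_of_mem h3, indicator_of_mem hq]
                  · rw [indicator_of_notMem hq]
                    exact bot_le
              _ ≤ ∑' l : Λ, ((x * z) • Q).indicator (fun _ => (1 : ℝ≥0∞)) (l : G) :=
                  ENNReal.sum_le_tsum s
              _ ≤ N := by
                  rw [tsum_indicator_one_eq_encard]
                  exact_mod_cast hN (x * z)
      _ = N * ∫⁻ z in Cᶜ, m z ∂μ := by
          rw [lintegral_indicator hC.measurableSet.compl, lintegral_const_mul _ hm]
      _ ≤ (N + 1) * δ := by
          gcongr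
          exact le_self_add
      _ = μ Q * ENNReal.ofReal η := by
          rw [hδ, ENNReal.mul_div_cancel (by simp)
            (ENNReal.add_ne_top.mpr ⟨ENNReal.natCast_ne_top N, ENNReal.one_ne_top⟩)]
  have h4 := (ENNReal.mul_le_mul_iff_right hQ0 hQt).mp hkey
  have h5 : ∑ l ∈ s, ‖F (x⁻¹ * l)‖ₑ ^ 2 = ENNReal.ofReal (∑ l ∈ s, ‖F (x⁻¹ * l)‖ ^ 2) := by
    rw [ENNReal.ofReal_sum_of_nonneg fun l _ => by positivity]
    refine Finset.sum_congr rfl fun l _ => ?_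
    rw [ENNReal.ofReal_pow (norm_nonneg _), ofReal_norm]
  rw [h5] at h4
  exact (ENNReal.ofReal_le_ofReal_iff hη.le).mp h4

end LocalMax

/-! ### Square-integrability of coefficients and relative separation -/

namespace ProjUnitaryRep

section FormalDegree

variable {G H : Type*} [Group G] [TopologicalSpace G] [MeasurableSpace G]
  [NormedAddCommGroup H] [InnerProductSpace ℂ H] {π : ProjUnitaryRep G H} {μ : Measure G} {d : ℝ}

theorem IsFormalDegree.memLp_coeff (hd : π.IsFormalDegree μ d) (g f : H) :
    MemLp (π.coeff g f) 2 μ := by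
  rcases eq_or_ne g 0 with rfl | hg
  · have : π.coeff (0 : H) f = 0 := by
      funext x
      simp [coeff]
    rw [this]
    exact MemLp.zero
  rcases eq_or_ne f 0 with rfl | hf
  · have : π.coeff g (0 : H) = 0 := by
      funext x
      simp [coeff]
    rw [this]
    exact MemLp.zero
  rw [memLp_coeff_iff]
  have h := hd.2 f f g g
  -- The Bochner integral of a non-integrable function is 0, so a nonzero value in the orthogonality
  -- relation forces integrability.
  have hne : (d : ℂ)⁻¹ * inner ℂ f f * (starRingEnd ℂ) (inner ℂ g g) ≠ 0 := by
    have : (d : ℂ) ≠ 0 := by exact_mod_cast hd.1.ne'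
    simp [this, hf, hg]
  rw [← h] at hne
  have hi := (Integrable.of_integral_ne_zero hne).norm
  refine hi.congr (Eventually.of_forall fun x => ?_)
  simp [sq]

theorem IsFormalDegree.integral_norm_coeff_sq (hd : π.IsFormalDegree μ d) (g f : H) :
    ∫ x, ‖π.coeff g f x‖ ^ 2 ∂μ = d⁻¹ * ‖f‖ ^ 2 * ‖g‖ ^ 2 := by
  have h := hd.2 f f g g
  have h1 : ∫ x, π.coeff g f x * (starRingEnd ℂ) (π.coeff g f x) ∂μ =
      ((∫ x, ‖π.coeff g f x‖ ^ 2 ∂μ : ℝ) : ℂ) := by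
    rw [← integral_complex_ofReal]
    refine integral_congr_ae (Eventually.of_forall fun x => ?_)
    simp only [Complex.mul_conj, Complex.normSq_eq_norm_sq]
  rw [h1, inner_self_eq_norm_sq_to_K, inner_self_eq_norm_sq_to_K] at h
  have h2 : ((∫ x, ‖π.coeff g f x‖ ^ 2 ∂μ : ℝ) : ℂ) = ((d⁻¹ * ‖f‖ ^ 2 * ‖g‖ ^ 2 : ℝ) : ℂ) := by
    rw [h]
    simp
  exact_mod_cast h2

end FormalDegree

section Separation

variable {G H : Type*} [Group G] [TopologicalSpace G] [IsTopologicalGroup G]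
  [SigmaCompactSpace G] [T2Space G] [MeasurableSpace G] [BorelSpace G]
  [NormedAddCommGroup H] [InnerProductSpace ℂ H] {π : ProjUnitaryRep G H} {μ : Measure G}
  [μ.IsMulLeftInvariant] [IsFiniteMeasureOnCompacts μ] {d : ℝ}

/-- The index set of a coherent Bessel system is relatively separated. -/
theorem IsFormalDegree.exists_encard_le (hd : π.IsFormalDegree μ d) {g : H} (hg : g ≠ 0)
    {Λ : Set G} {B : ℝ}
    (hB : ∀ (s : Finset Λ) (f : H), ∑ l ∈ s, ‖inner ℂ (π (l : G) g) f‖ ^ 2 ≤ B * ‖f‖ ^ 2)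
    {C : Set G} (hC : IsCompact C) : ∃ N : ℕ, ∀ y : G, (Λ ∩ y • C).encard ≤ N := by
  have hφm : Measurable fun x => ‖π.coeff g g x‖ₑ ^ 2 :=
    (π.stronglyMeasurable_coeff g g).measurable.enorm.pow_const 2
  have hne : ∫⁻ x, ‖π.coeff g g x‖ₑ ^ 2 ∂μ ≠ 0 := by
    intro h0
    have h1 := hd.integral_norm_coeff_sq g g
    rw [lintegral_eq_zero_iff hφm] at h0
    have h2 : ∫ x, ‖π.coeff g g x‖ ^ 2 ∂μ = 0 := by
      rw [integral_eq_zero_of_ae]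
      filter_upwards [h0] with x hx
      simpa using hx
    rw [h2] at h1
    have : 0 < d⁻¹ * ‖g‖ ^ 2 * ‖g‖ ^ 2 := by
      have := inv_pos.mpr hd.1
      positivity
    linarith
  obtain ⟨D, hD, hδ⟩ := exists_isCompact_setLIntegral_ne_zero hne
  set δ := ∫⁻ x in D, ‖π.coeff g g x‖ₑ ^ 2 ∂μ with hδdef
  have htop : ENNReal.ofReal (B * ‖g‖ ^ 2) * μ (C * D) / δ ≠ ∞ :=
    ENNReal.div_ne_top (ENNReal.mul_ne_top ENNReal.ofReal_ne_top (hC.mul hD).measure_lt_top.ne) hδ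
  obtain ⟨N, hN⟩ := ENNReal.exists_nat_gt htop
  have hfin : ∀ (y : G) (s : Finset Λ), (∀ l ∈ s, (l : G) ∈ y • C) → s.card ≤ N := by
    intro y s hs
    have hmE : MeasurableSet (y • (C * D)) := ((hC.mul hD).smul y).measurableSet
    -- The Bessel inequality for π(x)g is integrated over yCD. Every l in yC contributes at least δ,
    -- since lD ⊆ yCD.
    have h1 : (s.card : ℝ≥0∞) * δ ≤ ENNReal.ofReal (B * ‖g‖ ^ 2) * μ (C * D) := by
      calc (s.card : ℝ≥0∞) * δ = ∑ l ∈ s, δ := by rw [Finset.sum_const, nsmul_eq_mul]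
        _ ≤ ∑ l ∈ s, ∫⁻ x in y • (C * D), ‖π.coeff g g ((l : G)⁻¹ * x)‖ₑ ^ 2 ∂μ := by
            refine Finset.sum_le_sum fun l hl => ?_
            rw [hδdef, ← lintegral_indicator hD.measurableSet, ← lintegral_indicator hmE,
              ← lintegral_mul_left_eq_self ((y • (C * D)).indicator fun x =>
                ‖π.coeff g g ((l : G)⁻¹ * x)‖ₑ ^ 2) (l : G)]
            refine lintegral_mono fun x => ?_
            by_cases hx : x ∈ D
            · rw [indicator_of_mem hx, indicator_of_mem, inv_mul_cancel_left]
              obtain ⟨c, hc, hcl⟩ := hs l hl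
              refine ⟨c * x, Set.mul_mem_mul hc hx, ?_⟩
              simp only [smul_eq_mul] at hcl ⊢
              rw [← hcl, mul_assoc]
            · rw [indicator_of_notMem hx]
              exact bot_le
        _ = ∫⁻ x in y • (C * D), ∑ l ∈ s, ‖π.coeff g g ((l : G)⁻¹ * x)‖ₑ ^ 2 ∂μ :=
            (lintegral_finsetSum _ fun l _ => hφm.comp (measurable_const_mul _)).symm
        _ ≤ ∫⁻ x in y • (C * D), ENNReal.ofReal (B * ‖g‖ ^ 2) ∂μ := by
            refine lintegral_mono fun x => ?_
            have h2 := hB s (π x g)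
            rw [LinearIsometryEquiv.norm_map] at h2
            refine le_trans (le_of_eq ?_) (ENNReal.ofReal_le_ofReal h2)
            rw [ENNReal.ofReal_sum_of_nonneg fun l _ => by positivity]
            refine Finset.sum_congr rfl fun l _ => ?_
            rw [ENNReal.ofReal_pow (norm_nonneg _), norm_inner_map_map, ofReal_norm]
        _ = ENNReal.ofReal (B * ‖g‖ ^ 2) * μ (C * D) := by
            rw [setLIntegral_const, measure_smul]
    have h2 : (s.card : ℝ≥0∞) < N := by
      refine lt_of_le_of_lt ?_ hN
      rw [ENNReal.le_div_iff_mul_le (Or.inl hδ) (Or.inr (ENNReal.mul_ne_top ENNReal.ofReal_ne_top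
        (hC.mul hD).measure_lt_top.ne))]
      exact h1
    exact_mod_cast h2.le
  refine ⟨N, fun y => ?_⟩
  by_contra hlt
  rw [not_le] at hlt
  have h3 : ((N + 1 : ℕ) : ℕ∞) ≤ (Λ ∩ y • C).encard := by
    push_cast
    exact Order.add_one_le_of_lt hlt
  obtain ⟨t, ht, htc⟩ := exists_subset_encard_eq h3
  have htf : t.Finite := finite_of_encard_eq_coe htc
  classical
  have h4 := hfin y (htf.toFinset.subtype (· ∈ Λ)) (fun l hl => by
    rw [Finset.mem_subtype, Finite.mem_toFinset] at hl
    exact (ht hl).2)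
  rw [Finset.card_subtype, Finset.filter_true_of_mem (fun l hl =>
    (ht ((Finite.mem_toFinset htf).mp hl)).1), ← ncard_eq_toFinset_card t htf, ncard,
    htc] at h4
  simp only [ENat.toNat_natCast] at h4
  omega

end Separation

end ProjUnitaryRep

theorem norm_mul_le_weighted_sq (a b : ℂ) {t : ℝ} (ht : 0 < t) :
    ‖a * b‖ ≤ (t⁻¹ * ‖a‖ ^ 2 + t * ‖b‖ ^ 2) / 2 := by
  rw [norm_mul]
  have h1 : 0 ≤ t⁻¹ * (‖a‖ - t * ‖b‖) ^ 2 := by positivity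
  have h2 : t⁻¹ * (‖a‖ - t * ‖b‖) ^ 2 = t⁻¹ * ‖a‖ ^ 2 + t * ‖b‖ ^ 2 - 2 * (‖a‖ * ‖b‖) := by
    field_simp
    ring
  linarith

/-! ### Localised trace comparison -/

namespace ProjUnitaryRep

variable {G H : Type*} [Group G] [TopologicalSpace G] [MeasurableSpace G]
  [NormedAddCommGroup H] [InnerProductSpace ℂ H] {π : ProjUnitaryRep G H} {μ : Measure G} {d : ℝ}
  {g : H} {R : H →L[ℂ] H}

variable (π) in
/-- The contribution of the rank-one operator `f ↦ ⟨f, R u⟩ u` to the trace at the coherent state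
`π x g`. -/
noncomputable def traceDensity (g : H) (R : H →L[ℂ] H) (u : H) (x : G) : ℝ :=
  (inner ℂ (π x g) u * inner ℂ u (R (π x g))).re

theorem traceDensity_eq_coeff (hR : ∀ f f', inner ℂ (R f) f' = inner ℂ f (R f')) (u : H) (x : G) :
    π.traceDensity g R u x = (π.coeff g u x * (starRingEnd ℂ) (π.coeff g (R u) x)).re := by
  rw [traceDensity, coeff, coeff, inner_conj_symm, hR]

theorem abs_traceDensity_le (u : H) (x : G) {t : ℝ} (ht : 0 < t) :
    |π.traceDensity g R u x| ≤
      (t⁻¹ * ‖inner ℂ u (π x g)‖ ^ 2 + t * ‖inner ℂ u (R (π x g))‖ ^ 2) / 2 := by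
  refine (Complex.abs_re_le_norm _).trans ?_
  rw [norm_inner_symm u (π x g)]
  exact norm_mul_le_weighted_sq _ _ ht

theorem IsFormalDegree.integrable_traceDensity (hd : π.IsFormalDegree μ d)
    (hR : ∀ f f', inner ℂ (R f) f' = inner ℂ f (R f')) (u : H) :
    Integrable (π.traceDensity g R u) μ := by
  have h : Integrable (fun x => π.coeff g u x * (starRingEnd ℂ) (π.coeff g (R u) x)) μ :=
    (hd.memLp_coeff g u).integrable_mul (hd.memLp_coeff g (R u)).star
  refine h.re.congr (Eventually.of_forall fun x => ?_)
  exact (traceDensity_eq_coeff hR u x).symm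

theorem IsFormalDegree.integral_traceDensity (hd : π.IsFormalDegree μ d)
    (hR : ∀ f f', inner ℂ (R f) f' = inner ℂ f (R f')) (u : H) :
    ∫ x, π.traceDensity g R u x ∂μ = d⁻¹ * ‖g‖ ^ 2 * (inner ℂ u (R u)).re := by
  have h : Integrable (fun x => π.coeff g u x * (starRingEnd ℂ) (π.coeff g (R u) x)) μ :=
    (hd.memLp_coeff g u).integrable_mul (hd.memLp_coeff g (R u)).star
  have h1 := integral_re h
  simp_rw [traceDensity_eq_coeff hR]
  refine h1.trans ?_
  rw [hd.2, hR, inner_self_eq_norm_sq_to_K]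
  have h2 : (d : ℂ)⁻¹ * inner ℂ u (R u) * (starRingEnd ℂ) ((‖g‖ : ℂ) ^ 2) =
      ((d⁻¹ * ‖g‖ ^ 2 : ℝ) : ℂ) * inner ℂ u (R u) := by
    push_cast
    rw [map_pow, Complex.conj_ofReal]
    ring
  refine (congrArg Complex.re h2).trans ?_
  rw [Complex.re_ofReal_mul]

section Localization

variable [IsTopologicalGroup G] [BorelSpace G] [μ.IsMulLeftInvariant]

theorem IsFormalDegree.setIntegral_norm_coeff_translate_le (hd : π.IsFormalDegree μ d)
    {C E : Set G} (hC : MeasurableSet C) (hE : MeasurableSet E) {l : G} (hlE : l • C ⊆ E) :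
    ∫ x in Eᶜ, ‖π.coeff g (π l g) x‖ ^ 2 ∂μ ≤ ∫ x in Cᶜ, ‖π.coeff g g x‖ ^ 2 ∂μ := by
  have hi := (π.memLp_coeff_iff g g).mp (hd.memLp_coeff (μ := μ) g g)
  have hil := (π.memLp_coeff_iff g (π l g)).mp (hd.memLp_coeff (μ := μ) g (π l g))
  rw [← integral_indicator hE.compl, ← integral_indicator hC.compl,
    ← integral_mul_left_eq_self (Cᶜ.indicator fun x => ‖π.coeff g g x‖ ^ 2) l⁻¹]
  refine integral_mono (hil.indicator hE.compl)
    ((hi.indicator hC.compl).comp_mul_left l⁻¹) fun x => ?_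
  by_cases hx : x ∈ Eᶜ
  · have hx' : l⁻¹ * x ∈ Cᶜ := fun hxC => hx (hlE ⟨_, hxC, by simp⟩)
    rw [indicator_of_mem hx]
    simp only [indicator_of_mem hx']
    rw [coeff, norm_inner_symm, norm_inner_map_map]
  · rw [indicator_of_notMem hx]
    exact indicator_nonneg (fun _ _ => by positivity) _

/-- The full integral of the trace density is the left side. Off `E` it is a product of V_g(π(l)g),
whose tail is small there, and a factor bounded in `L²`; the weight `t` balances the two. -/
theorem IsFormalDegree.le_setIntegral_traceDensity_add (hd : π.IsFormalDegree μ d)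
    (hR : ∀ f f', inner ℂ (R f) f' = inner ℂ f (R f'))
    {C E : Set G} (hC : MeasurableSet C) (hE : MeasurableSet E) {l : G} (hlE : l • C ⊆ E)
    {t τ : ℝ} (ht : 0 < t) (hτ : ∫ x in Cᶜ, ‖π.coeff g g x‖ ^ 2 ∂μ ≤ τ) :
    d⁻¹ * ‖g‖ ^ 2 * (inner ℂ (π l g) (R (π l g))).re ≤
      ∫ x in E, π.traceDensity g R (π l g) x ∂μ +
        (t⁻¹ * τ + t * (d⁻¹ * (‖R‖ * ‖g‖) ^ 2 * ‖g‖ ^ 2)) / 2 := by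
  have hi : ∀ f, Integrable (fun x => ‖π.coeff g f x‖ ^ 2) μ := fun f =>
    (π.memLp_coeff_iff g f).mp (hd.memLp_coeff (μ := μ) g f)
  rw [← hd.integral_traceDensity (μ := μ) hR,
    ← integral_add_compl hE (hd.integrable_traceDensity hR _)]
  gcongr
  have hle : ∀ x, π.traceDensity g R (π l g) x ≤
      (t⁻¹ * ‖π.coeff g (π l g) x‖ ^ 2 + t * ‖π.coeff g (R (π l g)) x‖ ^ 2) / 2 := by
    intro x
    refine (le_abs_self _).trans ((abs_traceDensity_le _ x ht).trans (le_of_eq ?_))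
    rw [coeff, coeff, norm_inner_symm (π x g) (π l g), norm_inner_symm (π x g) (R (π l g)), hR]
  have hint : Integrable (fun x =>
      (t⁻¹ * ‖π.coeff g (π l g) x‖ ^ 2 + t * ‖π.coeff g (R (π l g)) x‖ ^ 2) / 2) μ :=
    (((hi _).const_mul _).add ((hi _).const_mul _)).div_const 2
  refine (setIntegral_mono (hd.integrable_traceDensity hR _).integrableOn
    hint.integrableOn hle).trans ?_
  rw [integral_div, integral_add ((hi _).const_mul _).integrableOn
    ((hi _).const_mul _).integrableOn, integral_const_mul, integral_const_mul]
  have h1 := (hd.setIntegral_norm_coeff_translate_le (g := g) hC hE hlE).trans hτ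
  have h2 : ∫ x in Eᶜ, ‖π.coeff g (R (π l g)) x‖ ^ 2 ∂μ ≤
      d⁻¹ * (‖R‖ * ‖g‖) ^ 2 * ‖g‖ ^ 2 := by
    refine (setIntegral_le_integral (hi _) (Eventually.of_forall fun x => by positivity)).trans ?_
    rw [hd.integral_norm_coeff_sq]
    have h3 := R.le_opNorm (π l g)
    rw [LinearIsometryEquiv.norm_map] at h3
    have := (inv_pos.mpr hd.1).le
    gcongr
  have ht' := (inv_pos.mpr ht).le
  gcongr

end Localization

/-- Over all indices the trace densities sum to ‖g‖². They may be negative, so the indices outside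
`F` cannot simply be dropped: the tail hypothesis and the Bessel bound for R π(x)g control them. -/
theorem sum_traceDensity_le_of_reconstruction {ι : Type*} {v : ι → H} {B : ℝ}
    (hB : ∀ (s : Finset ι) (f : H), ∑ i ∈ s, ‖inner ℂ (v i) f‖ ^ 2 ≤ B * ‖f‖ ^ 2) (hB0 : 0 ≤ B)
    (hsum : ∀ f f', HasSum (fun i => inner ℂ f (v i) * inner ℂ (v i) (R f')) (inner ℂ f f'))
    {x : G} {F : Finset ι} {t η : ℝ} (ht : 0 < t)
    (hη : ∀ s : Finset ι, Disjoint s F → ∑ i ∈ s, ‖inner ℂ (v i) (π x g)‖ ^ 2 ≤ η) :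
    ∑ i ∈ F, π.traceDensity g R (v i) x ≤
      ‖g‖ ^ 2 + (t⁻¹ * η + t * (B * (‖R‖ * ‖g‖) ^ 2)) / 2 := by
  classical
  have h := Complex.hasSum_re (hsum (π x g) (π x g))
  have hg : (inner ℂ (π x g) (π x g) : ℂ).re = ‖g‖ ^ 2 := by
    have := inner_self_eq_norm_sq (𝕜 := ℂ) (π x g)
    rw [LinearIsometryEquiv.norm_map] at this
    exact this
  rw [hg] at h
  rw [← sub_le_iff_le_add]
  refine ge_of_tendsto h ?_
  filter_upwards [eventually_ge_atTop F] with F' hF'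
  rw [← Finset.sum_sdiff hF', sub_le_iff_le_add]
  have h1 : -∑ i ∈ F' \ F, π.traceDensity g R (v i) x ≤
      (t⁻¹ * η + t * (B * (‖R‖ * ‖g‖) ^ 2)) / 2 := by
    rw [← Finset.sum_neg_distrib]
    refine (Finset.sum_le_sum fun i _ =>
      (neg_le_abs _).trans (abs_traceDensity_le (v i) x ht)).trans ?_
    rw [← Finset.sum_div, Finset.sum_add_distrib, ← Finset.mul_sum, ← Finset.mul_sum]
    have h2 := hη (F' \ F) Finset.sdiff_disjoint
    have h3 := hB (F' \ F) (R (π x g))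
    have h4 := R.le_opNorm (π x g)
    rw [LinearIsometryEquiv.norm_map] at h4
    have h5 : B * ‖R (π x g)‖ ^ 2 ≤ B * (‖R‖ * ‖g‖) ^ 2 := by gcongr
    have ht' := (inv_pos.mpr ht).le
    have h6 := h3.trans h5
    gcongr
  have h7 : ∑ i ∈ F' \ F, π.traceDensity g R (v i) x + ∑ i ∈ F, π.traceDensity g R (v i) x =
      ∑ i ∈ F' \ F, (inner ℂ (π x g) (v i) * inner ℂ (v i) (R (π x g))).re +
        ∑ i ∈ F, (inner ℂ (π x g) (v i) * inner ℂ (v i) (R (π x g))).re := rfl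
  linarith

/-- A crude bound without any tail hypothesis, for points x near the boundary of yK. -/
theorem sum_traceDensity_le_of_bessel {ι : Type*} {v : ι → H} {B : ℝ}
    (hB : ∀ (s : Finset ι) (f : H), ∑ i ∈ s, ‖inner ℂ (v i) f‖ ^ 2 ≤ B * ‖f‖ ^ 2) (hB0 : 0 ≤ B)
    (x : G) (F : Finset ι) :
    ∑ i ∈ F, π.traceDensity g R (v i) x ≤ (B * ‖g‖ ^ 2 + B * (‖R‖ * ‖g‖) ^ 2) / 2 := by
  refine (Finset.sum_le_sum fun i _ =>
    (le_abs_self _).trans (abs_traceDensity_le (v i) x one_pos)).trans ?_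
  rw [← Finset.sum_div, Finset.sum_add_distrib, inv_one]
  simp_rw [one_mul]
  have h2 := hB F (π x g)
  have h3 := hB F (R (π x g))
  have h4 := R.le_opNorm (π x g)
  rw [LinearIsometryEquiv.norm_map] at h2 h4
  have h5 : B * ‖R (π x g)‖ ^ 2 ≤ B * (‖R‖ * ‖g‖) ^ 2 := by gcongr
  linarith

section TraceEstimate

variable [IsTopologicalGroup G] [T2Space G] [BorelSpace G] [μ.IsMulLeftInvariant]
  [IsFiniteMeasureOnCompacts μ]

/-- Comparison of the trace of a partial frame operator over `y K` with the measure of `K C`. -/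
theorem IsFormalDegree.sum_re_inner_le (hd : π.IsFormalDegree μ d)
    (hR : ∀ f f', inner ℂ (R f) f' = inner ℂ f (R f')) {Λ : Set G} {B : ℝ}
    (hB : ∀ (s : Finset Λ) (f : H), ∑ l ∈ s, ‖inner ℂ (π (l : G) g) f‖ ^ 2 ≤ B * ‖f‖ ^ 2)
    (hB0 : 0 ≤ B)
    (hsum : ∀ f f', HasSum (fun l : Λ => inner ℂ f (π (l : G) g) * inner ℂ (π (l : G) g) (R f'))
      (inner ℂ f f'))
    {C K : Set G} (hC : IsCompact C) (hCs : C⁻¹ = C) (hK : IsCompact K) {t τ : ℝ} (ht : 0 < t)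
    (hτ : ∫ x in Cᶜ, ‖π.coeff g g x‖ ^ 2 ∂μ ≤ τ)
    (hη : ∀ᵐ x ∂μ, ∀ s : Finset Λ, (∀ l ∈ s, (l : G) ∉ x • C) →
      ∑ l ∈ s, ‖π.coeff g g (x⁻¹ * l)‖ ^ 2 ≤ τ)
    (hτ0 : 0 ≤ τ) {y : G} {F : Finset Λ} (hF : ∀ l : Λ, l ∈ F ↔ (l : G) ∈ y • K) :
    d⁻¹ * ‖g‖ ^ 2 * ∑ l ∈ F, (inner ℂ (π (l : G) g) (R (π (l : G) g))).re ≤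
      (‖g‖ ^ 2 + (t⁻¹ * τ + t * (B * (‖R‖ * ‖g‖) ^ 2)) / 2) * μ.real (K * C) +
      (B * ‖g‖ ^ 2 + B * (‖R‖ * ‖g‖) ^ 2) / 2 * μ.real ((K * C) ∩ (Kᶜ * C)) +
      F.card * ((t⁻¹ * τ + t * (d⁻¹ * (‖R‖ * ‖g‖) ^ 2 * ‖g‖ ^ 2)) / 2) := by
  set ε₁ := (t⁻¹ * τ + t * (B * (‖R‖ * ‖g‖) ^ 2)) / 2 with hε₁
  set ε₂ := (t⁻¹ * τ + t * (d⁻¹ * (‖R‖ * ‖g‖) ^ 2 * ‖g‖ ^ 2)) / 2 with hε₂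
  set M := (B * ‖g‖ ^ 2 + B * (‖R‖ * ‖g‖) ^ 2) / 2 with hM
  have hM0 : 0 ≤ M := by positivity
  have hε₁0 : 0 ≤ ε₁ := by positivity
  set E := y • (K * C) with hE
  set D := y • ((K * C) ∩ (Kᶜ * C)) with hD
  have hEc : IsCompact E := (hK.mul hC).smul y
  have hEm : MeasurableSet E := hEc.measurableSet
  have hDm : MeasurableSet D := by
    have : IsOpen (Kᶜ * C) := hK.isClosed.isOpen_compl.mul_right
    exact ((hK.mul hC).measurableSet.inter this.measurableSet).const_smul y
  have hDE : D ⊆ E := smul_set_mono inter_subset_left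
  have hEfin : μ E ≠ ∞ := hEc.measure_lt_top.ne
  have hterm : ∀ l ∈ F, d⁻¹ * ‖g‖ ^ 2 * (inner ℂ (π (l : G) g) (R (π (l : G) g))).re ≤
      ∫ x in E, π.traceDensity g R (π (l : G) g) x ∂μ + ε₂ := by
    intro l hl
    refine hd.le_setIntegral_traceDensity_add hR hC.measurableSet hEm ?_ ht hτ
    obtain ⟨k, hk, hkl⟩ := (hF l).mp hl
    rintro _ ⟨c, hc, rfl⟩
    refine ⟨k * c, Set.mul_mem_mul hk hc, ?_⟩
    simp only [smul_eq_mul] at hkl ⊢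
    rw [← hkl, mul_assoc]
  -- If l ∈ xC lies outside yK, symmetry of `C` puts x in y(KᶜC). Hence for x in `E` off `D` all
  -- points of Λ ∩ xC belong to `F`, and the tail bound applies.
  have hpt : ∀ᵐ x ∂μ, x ∈ E → ∑ l ∈ F, π.traceDensity g R (π (l : G) g) x ≤
      (‖g‖ ^ 2 + ε₁) + D.indicator (fun _ => M) x := by
    filter_upwards [hη] with x hx hxE
    by_cases hxD : x ∈ D
    · rw [indicator_of_mem hxD]
      have := sum_traceDensity_le_of_bessel (π := π) (R := R) (g := g) hB hB0 x F
      have h0 : 0 ≤ ‖g‖ ^ 2 := by positivity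
      linarith
    · rw [indicator_of_notMem hxD, add_zero]
      refine sum_traceDensity_le_of_reconstruction hB hB0 hsum ht fun s hs => ?_
      have h1 := hx s fun l hl hlx => ?_
      · refine le_trans (le_of_eq (Finset.sum_congr rfl fun l _ => ?_)) h1
        rw [norm_inner_symm, norm_inner_map_map]
      · refine Finset.disjoint_left.mp hs hl ((hF l).mpr ?_)
        obtain ⟨c, hc, hcl⟩ := hlx
        obtain ⟨z, hz, hzx⟩ := hxE
        by_contra hlK
        refine hxD ⟨z, ⟨hz, y⁻¹ * l, fun hmem => hlK ⟨_, hmem, by simp⟩, c⁻¹, ?_, ?_⟩, hzx⟩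
        · rw [← hCs]
          exact Set.inv_mem_inv.mpr hc
        · simp only [smul_eq_mul] at hcl hzx ⊢
          rw [← hcl, ← hzx]
          group
  have hint : IntegrableOn (fun x => ∑ l ∈ F, π.traceDensity g R (π (l : G) g) x) E μ :=
    (integrable_finsetSum _ fun l _ => hd.integrable_traceDensity hR _).integrableOn
  have hintD : IntegrableOn (D.indicator fun _ => M) E μ :=
    (integrableOn_const hEfin).indicator hDm
  have hconst : IntegrableOn (fun _ : G => ‖g‖ ^ 2 + ε₁) E μ := integrableOn_const hEfin
  have hmain : ∫ x in E, ∑ l ∈ F, π.traceDensity g R (π (l : G) g) x ∂μ ≤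
      (‖g‖ ^ 2 + ε₁) * μ.real (K * C) + M * μ.real ((K * C) ∩ (Kᶜ * C)) := by
    refine (integral_mono_ae hint (hconst.add hintD)
      ((ae_restrict_iff' hEm).mpr hpt)).trans (le_of_eq ?_)
    simp only [Pi.add_apply]
    rw [integral_add hconst hintD, setIntegral_const,
      setIntegral_indicator hDm, inter_eq_right.mpr hDE, setIntegral_const, smul_eq_mul,
      smul_eq_mul, mul_comm, mul_comm _ M, Measure.real, Measure.real, hE, hD, measure_smul,
      measure_smul]
    rfl
  rw [integral_finsetSum _ fun l _ => (hd.integrable_traceDensity hR _).integrableOn] at hmain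
  rw [Finset.mul_sum]
  refine (Finset.sum_le_sum hterm).trans ?_
  rw [Finset.sum_add_distrib, Finset.sum_const, nsmul_eq_mul]
  gcongr

end TraceEstimate

end ProjUnitaryRep

/-! ### Measures along Følner sequences -/

section Folner

variable {G : Type*} [Group G] [TopologicalSpace G] [MeasurableSpace G] {μ : Measure G}
  [IsFiniteMeasureOnCompacts μ] {K : ℕ → Set G}

theorem IsFolnerSeq.eventually_measureReal_le (hK : IsFolnerSeq μ K) {S : ℕ → Set G}
    (hS : Tendsto (fun n => μ (S n) / μ (K n)) atTop (𝓝 0)) {a : ℝ} (ha : 0 < a) :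
    ∀ᶠ n in atTop, μ.real (S n) ≤ a * μ.real (K n) := by
  filter_upwards [hS.eventually_le_const (ENNReal.ofReal_pos.mpr ha)] with n hn
  have hKt : μ (K n) ≠ ∞ := (hK.isCompact n).measure_lt_top.ne
  rw [ENNReal.div_le_iff (hK.measure_ne_zero n) hKt] at hn
  have h := ENNReal.toReal_mono (ENNReal.mul_ne_top ENNReal.ofReal_ne_top hKt) hn
  rwa [ENNReal.toReal_mul, ENNReal.toReal_ofReal ha.le] at h

variable [IsTopologicalGroup G]

theorem IsFolnerSeq.eventually_measureReal_mul_le (hK : IsFolnerSeq μ K) {C : Set G}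
    (hC : IsCompact C) (hCne : C.Nonempty) {a : ℝ} (ha : 0 < a) :
    ∀ᶠ n in atTop, μ.real (K n * C) ≤ (1 + a) * μ.real (K n) := by
  filter_upwards [hK.eventually_measureReal_le (hK.tendsto_symmDiff C hC hCne) ha] with n hn
  have hsub : K n * C ⊆ K n ∪ symmDiff (K n * C) (K n) := by
    intro x hx
    by_cases hxK : x ∈ K n
    · exact Or.inl hxK
    · exact Or.inr (Or.inl ⟨hx, hxK⟩)
  have hfin : μ (K n ∪ symmDiff (K n * C) (K n)) ≠ ∞ := by
    refine ne_top_of_le_ne_top (((hK.isCompact n).mul hC).union (hK.isCompact n)).measure_lt_top.ne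
      (measure_mono ?_)
    exact union_subset subset_union_right (symmDiff_le_sup (a := K n * C) (b := K n))
  have h1 := (measureReal_mono hsub hfin).trans (measureReal_union_le _ _)
  linarith

end Folner

section FolnerHaar

variable {G : Type*} [Group G] [TopologicalSpace G] [IsTopologicalGroup G]
  [LocallyCompactSpace G] [T2Space G] [SecondCountableTopology G] [NoncompactSpace G]
  [MeasurableSpace G] [BorelSpace G] {μ : Measure G} [μ.IsHaarMeasure] {K : ℕ → Set G}

/-- A non-compact group has infinite Haar measure, so a compact `C` can be arbitrarily large, while
eventually μ(C) ≤ μ(K_n C) ≤ 2μ(K_n). -/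
theorem IsFolnerSeq.tendsto_measureReal_atTop (hK : IsFolnerSeq μ K) :
    Tendsto (fun n => μ.real (K n)) atTop atTop := by
  rw [tendsto_atTop]
  intro r
  have huniv : μ univ = ∞ := measure_univ_of_isMulLeftInvariant μ
  obtain ⟨C, -, hC, hrC⟩ := isOpen_univ.exists_lt_isCompact
    (show ENNReal.ofReal (2 * |r| + 1) < μ univ by rw [huniv]; exact ENNReal.ofReal_lt_top)
  have hCne : C.Nonempty := by
    by_contra h
    rw [not_nonempty_iff_eq_empty.mp h, measure_empty] at hrC
    exact not_lt_bot hrC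
  filter_upwards [hK.eventually_measureReal_mul_le hC hCne one_pos] with n hn
  have hKne : (K n).Nonempty := nonempty_of_measure_ne_zero (hK.measure_ne_zero n)
  obtain ⟨k, hk⟩ := hKne
  have hsub : k • C ⊆ K n * C := by
    rintro _ ⟨c, hc, rfl⟩
    exact Set.mul_mem_mul hk hc
  have h1 : μ.real C ≤ μ.real (K n * C) := by
    have := measureReal_mono hsub (((hK.isCompact n).mul hC).measure_lt_top (μ := μ)).ne
    rwa [Measure.real, measure_smul] at this
  have h2 : 2 * |r| + 1 ≤ μ.real C := by
    have := ENNReal.toReal_mono hC.measure_lt_top.ne hrC.le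
    rwa [ENNReal.toReal_ofReal (by positivity)] at this
  have := le_abs_self r
  linarith

end FolnerHaar

theorem IsFrame.exists_bessel_bound {ι H : Type*} [NormedAddCommGroup H] [InnerProductSpace ℂ H]
    {v : ι → H} (hv : IsFrame v) :
    ∃ B : ℝ, 0 ≤ B ∧ ∀ (s : Finset ι) (f : H), ∑ i ∈ s, ‖inner ℂ (v i) f‖ ^ 2 ≤ B * ‖f‖ ^ 2 := by
  obtain ⟨A, B, hA, hB, hAB⟩ := hv
  exact ⟨B, hB.le, fun s f =>
    ((hAB f).1.sum_le_tsum s fun i _ => by positivity).trans (hAB f).2.2⟩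

/-! ### Density against formal degree -/

namespace ProjUnitaryRep

section Tails

variable {G H : Type*} [Group G] [TopologicalSpace G] [SigmaCompactSpace G] [T2Space G]
  [MeasurableSpace G] [BorelSpace G] {μ : Measure G}
  [NormedAddCommGroup H] [InnerProductSpace ℂ H] {π : ProjUnitaryRep G H} {d : ℝ} {g : H}

theorem IsFormalDegree.exists_isCompact_setIntegral_compl_le (hd : π.IsFormalDegree μ d) {τ : ℝ}
    (hτ : 0 < τ) : ∃ C : Set G, IsCompact C ∧ ∫ x in Cᶜ, ‖π.coeff g g x‖ ^ 2 ∂μ ≤ τ := by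
  have hi := (π.memLp_coeff_iff g g).mp (hd.memLp_coeff (μ := μ) g g)
  have hfin : ∫⁻ x, ENNReal.ofReal (‖π.coeff g g x‖ ^ 2) ∂μ ≠ ∞ := by
    rw [← ofReal_integral_eq_lintegral_ofReal hi (Eventually.of_forall fun x => by positivity)]
    exact ENNReal.ofReal_ne_top
  obtain ⟨C, hC, hle⟩ := exists_isCompact_setLIntegral_compl_le hfin
    (ENNReal.ofReal_pos.mpr hτ).ne'
  refine ⟨C, hC, ?_⟩
  rw [← ofReal_integral_eq_lintegral_ofReal hi.integrableOn
    (Eventually.of_forall fun x => by positivity)] at hle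
  exact (ENNReal.ofReal_le_ofReal_iff hτ.le).mp hle

end Tails

variable {G H : Type*} [Group G] [TopologicalSpace G] [IsTopologicalGroup G]
  [LocallyCompactSpace G] [T2Space G] [SecondCountableTopology G]
  [MeasurableSpace G] [BorelSpace G] {μ : Measure G} [μ.IsHaarMeasure] [μ.IsMulRightInvariant]
  [NormedAddCommGroup H] [InnerProductSpace ℂ H] {π : ProjUnitaryRep G H} {d : ℝ}
  {g : H} {R : H →L[ℂ] H}

/-- Along a strong Følner sequence, the trace of the partial sums of `∑ ⟨f, R v l⟩ v l` over
translates of `K n` is asymptotically at most `d μ (K n)`. -/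
theorem IsFormalDegree.eventually_sum_re_inner_le (hd : π.IsFormalDegree μ d) (hg : g ≠ 0)
    {Q : Set G} (hQ : IsCompact Q) (hQ1 : Q ∈ 𝓝 (1 : G)) (hQs : Q⁻¹ = Q) (hgQ : g ∈ π.B2 μ Q)
    {K : ℕ → Set G} (hK : IsStrongFolnerSeq μ K)
    (hR : ∀ f f', inner ℂ (R f) f' = inner ℂ f (R f')) {Λ : Set G} [Countable Λ] {B : ℝ}
    (hB : ∀ (s : Finset Λ) (f : H), ∑ l ∈ s, ‖inner ℂ (π (l : G) g) f‖ ^ 2 ≤ B * ‖f‖ ^ 2)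
    (hB0 : 0 ≤ B)
    (hsum : ∀ f f', HasSum (fun l : Λ => inner ℂ f (π (l : G) g) * inner ℂ (π (l : G) g) (R f'))
      (inner ℂ f f')) {ε : ℝ} (hε : 0 < ε) :
    ∀ᶠ n in atTop, ∀ (y : G) (F : Finset Λ), (∀ l : Λ, l ∈ F ↔ (l : G) ∈ y • K n) →
      ∑ l ∈ F, (inner ℂ (π (l : G) g) (R (π (l : G) g))).re ≤
        (d + ε) * μ.real (K n) + ε * F.card := by
  have hd0 := hd.1
  have hg0 : 0 < ‖g‖ ^ 2 := by positivity
  set b₁ := B * (‖R‖ * ‖g‖) ^ 2 with hb₁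
  set b₂ := d⁻¹ * (‖R‖ * ‖g‖) ^ 2 * ‖g‖ ^ 2 with hb₂
  set M := (B * ‖g‖ ^ 2 + B * (‖R‖ * ‖g‖) ^ 2) / 2 with hM
  have hb₁0 : 0 ≤ b₁ := by positivity
  have hb₂0 : 0 ≤ b₂ := by positivity
  have hM0 : 0 ≤ M := by positivity
  -- Dividing by d⁻¹‖g‖² at the end turns 2e into ε. The tail size is τ = te, so that t⁻¹τ = e, and
  -- t makes both t b₁ and t b₂ at most e.
  set e := ε * d⁻¹ * ‖g‖ ^ 2 / 2 with he
  have he0 : 0 < e := by positivity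
  set t := e / (b₁ + b₂ + 1) with ht
  have ht0 : 0 < t := by positivity
  have ht₁ : t * b₁ ≤ e := by
    rw [ht, div_mul_eq_mul_div, div_le_iff₀ (by positivity)]
    exact mul_le_mul_of_nonneg_left (by linarith) he0.le
  have ht₂ : t * b₂ ≤ e := by
    rw [ht, div_mul_eq_mul_div, div_le_iff₀ (by positivity)]
    exact mul_le_mul_of_nonneg_left (by linarith) he0.le
  have hτ : t⁻¹ * (t * e) = e := by rw [inv_mul_cancel_left₀ ht0.ne']
  have hτ0 : 0 < t * e := by positivity
  obtain ⟨N, hN⟩ := hd.exists_encard_le hg hB hQ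
  obtain ⟨C₁, hC₁, hC₁τ⟩ := hd.exists_isCompact_setIntegral_compl_le (g := g) hτ0
  obtain ⟨C₂, hC₂, hC₂τ⟩ := MemAmalgam.exists_isCompact_tail_le hQ hQs hQ1
    (π.stronglyMeasurable_coeff g g).measurable hgQ hN hτ0
  -- The point 1 secures nonemptiness, which the Følner condition requires.
  set C₀ := C₁ ∪ C₂ ∪ {1} with hC₀
  set C := C₀ ∪ C₀⁻¹ with hC
  have hC₀c : IsCompact C₀ := (hC₁.union hC₂).union isCompact_singleton
  have hCc : IsCompact C := hC₀c.union hC₀c.inv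
  have hCs : C⁻¹ = C := by rw [hC, union_inv, inv_inv, union_comm]
  have hC₁C : C₁ ⊆ C := fun x hx => Or.inl (Or.inl (Or.inl hx))
  have hC₂C : C₂ ⊆ C := fun x hx => Or.inl (Or.inl (Or.inr hx))
  have hCne : C.Nonempty := ⟨1, Or.inl (Or.inr rfl)⟩
  have hCτ : ∫ x in Cᶜ, ‖π.coeff g g x‖ ^ 2 ∂μ ≤ t * e := by
    refine (setIntegral_mono_set ?_ (Eventually.of_forall fun x => by positivity)
      (compl_subset_compl.mpr hC₁C).eventuallyLE).trans hC₁τ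
    exact ((π.memLp_coeff_iff g g).mp (hd.memLp_coeff (μ := μ) g g)).integrableOn
  have hCη : ∀ᵐ x ∂μ, ∀ s : Finset Λ, (∀ l ∈ s, (l : G) ∉ x • C) →
      ∑ l ∈ s, ‖π.coeff g g (x⁻¹ * l)‖ ^ 2 ≤ t * e := by
    filter_upwards [hC₂τ] with x hx s hs
    exact hx s fun l hl hmem => hs l hl (smul_set_mono hC₂C hmem)
  set a := e / (‖g‖ ^ 2 + e + M + 1) with ha
  have ha0 : 0 < a := by positivity
  have ha₁ : a * (‖g‖ ^ 2 + e + M) ≤ e := by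
    rw [ha, div_mul_eq_mul_div, div_le_iff₀ (by positivity)]
    exact mul_le_mul_of_nonneg_left (by linarith) he0.le
  filter_upwards [hK.toIsFolnerSeq.eventually_measureReal_mul_le hCc hCne ha0,
    hK.toIsFolnerSeq.eventually_measureReal_le (hK.tendsto_boundary C hCc) ha0] with n hn₁ hn₂ y F hF
  have h := hd.sum_re_inner_le hR hB hB0 hsum hCc hCs (hK.isCompact n) ht0 hCτ hCη hτ0.le hF
  rw [← hb₁, ← hb₂, ← hM, hτ] at h
  set k := μ.real (K n)
  have hk : 0 ≤ k := measureReal_nonneg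
  set p := ∑ l ∈ F, (inner ℂ (π (l : G) g) (R (π (l : G) g))).re
  have hcard : (0 : ℝ) ≤ F.card := Nat.cast_nonneg _
  have h1 : d⁻¹ * ‖g‖ ^ 2 * p ≤ (‖g‖ ^ 2 + 2 * e) * k + F.card * e := by
    calc d⁻¹ * ‖g‖ ^ 2 * p
        ≤ (‖g‖ ^ 2 + (e + t * b₁) / 2) * μ.real (K n * C) +
          M * μ.real ((K n * C) ∩ ((K n)ᶜ * C)) + F.card * ((e + t * b₂) / 2) := h
      _ ≤ (‖g‖ ^ 2 + e) * ((1 + a) * k) + M * (a * k) + F.card * e := by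
          have h3 : (e + t * b₁) / 2 ≤ e := by linarith
          have h4 : (e + t * b₂) / 2 ≤ e := by linarith
          gcongr
      _ = (‖g‖ ^ 2 + e + a * (‖g‖ ^ 2 + e + M)) * k + F.card * e := by ring
      _ ≤ (‖g‖ ^ 2 + e + e) * k + F.card * e := by gcongr
      _ = (‖g‖ ^ 2 + 2 * e) * k + F.card * e := by ring
  have h2 : (‖g‖ ^ 2 + 2 * e) * k + F.card * e =
      d⁻¹ * ‖g‖ ^ 2 * ((d + ε) * k + ε / 2 * F.card) := by
    rw [he]
    field_simp
  rw [h2] at h1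
  have h3 := le_of_mul_le_mul_left h1 (by positivity)
  have h4 : ε / 2 * F.card ≤ ε * F.card := by
    apply mul_le_mul_of_nonneg_right _ hcard
    linarith
  linarith

/-- If the density of `Λ` exceeds the formal degree, then infinitely many of the numbers
`⟨v l, R v l⟩` are bounded away from `1`. -/
theorem IsFormalDegree.exists_infinite_re_inner_le [NoncompactSpace G]
    (hd : π.IsFormalDegree μ d) (hg : g ≠ 0)
    {Q : Set G} (hQ : IsCompact Q) (hQ1 : Q ∈ 𝓝 (1 : G)) (hQs : Q⁻¹ = Q) (hgQ : g ∈ π.B2 μ Q)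
    {K : ℕ → Set G} (hK : IsStrongFolnerSeq μ K)
    (hR : ∀ f f', inner ℂ (R f) f' = inner ℂ f (R f')) {Λ : Set G} [Countable Λ] {B : ℝ}
    (hB : ∀ (s : Finset Λ) (f : H), ∑ l ∈ s, ‖inner ℂ (π (l : G) g) f‖ ^ 2 ≤ B * ‖f‖ ^ 2)
    (hB0 : 0 ≤ B)
    (hsum : ∀ f f', HasSum (fun l : Λ => inner ℂ f (π (l : G) g) * inner ℂ (π (l : G) g) (R f'))
      (inner ℂ f f')) (hdens : ENNReal.ofReal d < upperBeurlingDensity μ K Λ) :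
    ∃ α < 1, {l : Λ | (inner ℂ (π (l : G) g) (R (π (l : G) g))).re ≤ α}.Infinite := by
  classical
  obtain ⟨D', hdD, hD'⟩ := ENNReal.lt_iff_exists_nnreal_btwn.mp hdens
  have hdD' : d < D' := by
    rw [← ENNReal.ofReal_coe_nnreal] at hdD
    exact (ENNReal.ofReal_lt_ofReal_iff_of_nonneg hd.1.le).mp hdD
  have hD0 : (0 : ℝ) < D' := hd.1.trans hdD'
  -- Chosen so that d + 2ε < (1 - 2ε)D', the inequality contradicted at the end.
  set ε := (D' - d) / (2 * (2 + 2 * (D' : ℝ))) with hε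
  have hε0 : 0 < ε := div_pos (sub_pos.mpr hdD') (by positivity)
  have hε1 : ε * (2 + 2 * D') < D' - d := by
    rw [hε]
    field_simp
    linarith
  have hε2 : 0 < 1 - 2 * ε := by nlinarith [hd.1]
  refine ⟨1 - ε, by linarith, fun hfin => ?_⟩
  set p : Λ → ℝ := fun l => (inner ℂ (π (l : G) g) (R (π (l : G) g))).re with hp
  have hp0 : ∀ l, 0 ≤ p l := fun l =>
    (hasSum_norm_inner_sq_of_reconstruction hR hsum (π (l : G) g)).nonneg fun j => by positivity
  -- If only finitely many p_l were at most 1 - ε, their number would eventually be at most ε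
  -- μ(K_n).
  have hlarge := hK.toIsFolnerSeq.tendsto_measureReal_atTop.eventually_ge_atTop
    (hfin.toFinset.card / ε)
  have htrace := hd.eventually_sum_re_inner_le hg hQ hQ1 hQs hgQ hK hR hB hB0 hsum hε0
  obtain ⟨n, hn, hn₁, hn₂⟩ :=
    ((frequently_lt_of_lt_limsup (by isBoundedDefault) hD').and_eventually
      (hlarge.and htrace)).exists
  obtain ⟨y, hy⟩ := lt_iSup_iff.mp hn
  obtain ⟨N, hN⟩ := hd.exists_encard_le hg hB (hK.isCompact n)
  have hΛfin : (Λ ∩ y • K n).Finite := finite_of_encard_le_coe (hN y)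
  set F : Finset Λ := hΛfin.toFinset.subtype (· ∈ Λ) with hFdef
  have hF : ∀ l : Λ, l ∈ F ↔ (l : G) ∈ y • K n := by
    intro l
    rw [hFdef, Finset.mem_subtype, Finite.mem_toFinset]
    exact ⟨fun h => h.2, fun h => ⟨l.2, h⟩⟩
  have hcard : (Λ ∩ y • K n).encard = F.card := by
    rw [hΛfin.encard_eq_coe_toFinset_card, hFdef, Finset.card_subtype,
      Finset.filter_true_of_mem fun l hl => ((Finite.mem_toFinset hΛfin).mp hl).1]
  have hKt : μ (K n) ≠ ∞ := (hK.isCompact n).measure_lt_top.ne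
  have hlt : (D' : ℝ) * μ.real (K n) < F.card := by
    rw [hcard, ENNReal.lt_div_iff_mul_lt (Or.inl (hK.measure_ne_zero n)) (Or.inl hKt)] at hy
    have h1 := (ENNReal.toReal_lt_toReal (ENNReal.mul_ne_top ENNReal.coe_ne_top hKt)
      (by simp)).mpr hy
    simpa [Measure.real] using h1
  have hle := hn₂ y F hF
  have hlow : (1 - ε) * (F.card - hfin.toFinset.card) ≤ ∑ l ∈ F, p l := by
    have h1 : (1 - ε) * ((F \ hfin.toFinset).card : ℝ) ≤ ∑ l ∈ F \ hfin.toFinset, p l := by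
      rw [mul_comm, ← nsmul_eq_mul]
      refine Finset.card_nsmul_le_sum _ _ _ fun l hl => ?_
      have h2 := (Finset.mem_sdiff.mp hl).2
      rw [Finite.mem_toFinset] at h2
      exact (not_le.mp h2).le
    have h3 : ∑ l ∈ F \ hfin.toFinset, p l ≤ ∑ l ∈ F, p l :=
      Finset.sum_le_sum_of_subset_of_nonneg Finset.sdiff_subset fun l _ _ => hp0 l
    have h4 : (F.card : ℝ) - hfin.toFinset.card ≤ ((F \ hfin.toFinset).card : ℝ) := by
      rw [sub_le_iff_le_add]
      exact_mod_cast Finset.card_le_card_sdiff_add_card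
    have h5 : 0 ≤ 1 - ε := by linarith
    exact (mul_le_mul_of_nonneg_left h4 h5).trans (h1.trans h3)
  have hN' : (hfin.toFinset.card : ℝ) ≤ ε * μ.real (K n) := by
    rw [div_le_iff₀ hε0] at hn₁
    linarith
  have hk : 0 < μ.real (K n) := ENNReal.toReal_pos (hK.measure_ne_zero n) hKt
  have h1 : (1 - 2 * ε) * F.card ≤ (d + 2 * ε) * μ.real (K n) := by
    have h2 : (1 - ε) * hfin.toFinset.card ≤ ε * μ.real (K n) := by
      refine le_trans ?_ hN'
      exact mul_le_of_le_one_left (Nat.cast_nonneg _) (by linarith)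
    linarith
  have h2 : (1 - 2 * ε) * (D' * μ.real (K n)) < (1 - 2 * ε) * F.card :=
    mul_lt_mul_of_pos_left hlt hε2
  have h3 : (d + 2 * ε) * μ.real (K n) < (1 - 2 * ε) * D' * μ.real (K n) :=
    mul_lt_mul_of_pos_right (by linarith) hk
  linarith

end ProjUnitaryRep

end CoherentFrame

theorem theorem4p2
    {G : Type*} [Group G] [TopologicalSpace G] [IsTopologicalGroup G] [LocallyCompactSpace G]
    [T2Space G] [SecondCountableTopology G] [NoncompactSpace G]
    [MeasurableSpace G] [BorelSpace G]
    (μ : Measure G) [μ.IsHaarMeasure] [μ.IsMulRightInvariant]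
    {H : Type*} [NormedAddCommGroup H] [InnerProductSpace ℂ H] [CompleteSpace H]
    (Q : Set G) (hQ_compact : IsCompact Q) (hQ_nhds : Q ∈ 𝓝 (1 : G)) (hQ_symm : Q⁻¹ = Q)
    (K : ℕ → Set G) (hK : CoherentFrame.IsStrongFolnerSeq μ K)
    (π : CoherentFrame.ProjUnitaryRep G H) (hπ : π.IsDiscreteSeries μ)
    (Λ : Set G) (hΛ : DiscreteTopology Λ)
    (g : H) (hg : g ∈ π.B2 μ Q)
    (hframe : CoherentFrame.IsFrame (fun l : Λ => π (l : G) g))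
    (hdensity : ENNReal.ofReal (π.formalDegree μ) < CoherentFrame.upperBeurlingDensity μ K Λ) :
    ∃ Γ : Set G, Γ ⊆ Λ ∧ Γ.Infinite ∧
      CoherentFrame.IsFrame (fun l : (Λ \ Γ : Set G) => π (l : G) g) := by
  have hcount : Countable Λ := countable_of_Lindelof_of_discrete
  have hd := hπ.isFormalDegree_formalDegree
  have hg0 : g ≠ 0 := by
    rintro rfl
    obtain ⟨h, h0, -⟩ := hπ.squareIntegrable
    obtain ⟨A, B, hA, hB, hAB⟩ := hframe
    have h1 := (hAB h).2.1
    simp only [map_zero, inner_zero_left, norm_zero, ne_eq, OfNat.ofNat_ne_zero, not_false_eq_true,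
      zero_pow, tsum_zero] at h1
    have : 0 < A * ‖h‖ ^ 2 := by positivity
    linarith
  obtain ⟨B, hB0, hB⟩ := hframe.exists_bessel_bound
  obtain ⟨R, hR, hsum⟩ := hframe.exists_reconstruction
  obtain ⟨α, hα, hJ⟩ := hd.exists_infinite_re_inner_le hg0 hQ_compact hQ_nhds hQ_symm hg hK hR hB
    hB0 hsum hdensity
  obtain ⟨Γ, -, hΓ, hΓframe⟩ := hframe.exists_infinite_compl hR hsum hJ hα fun l hl => hl
  refine ⟨(↑) '' Γ, Subtype.coe_image_subset Λ Γ, hΓ.image Subtype.val_injective.injOn, ?_⟩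
  let e : (Λ \ ((↑) '' Γ) : Set G) ≃ (Γᶜ : Set Λ) :=
    { toFun := fun l => ⟨⟨l, l.2.1⟩, fun h => l.2.2 ⟨_, h, rfl⟩⟩
      invFun := fun l => ⟨l, l.1.2, by
        rintro ⟨m, hm, hml⟩
        exact l.2 (Subtype.val_injective hml ▸ hm)⟩
      left_inv := fun l => rfl
      right_inv := fun l => rfl }
  exact hΓframe.comp_equiv e
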